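/- Let $d\ge 1$ be an integer, $\mathbb R^d_+=(0,\infty)^d$, and let $$l_n(x)=\prod_{j=1}^d L_{n_j}(x_j)e^{-x_j/2},\qquad L_k(t)=\frac{e^t}{k!}\frac{d^k}{dt^k}\left(e^{-t}t^k\right),\qquad n\in\mathbb N_0^d,\ x\in\mathbb R^d_+,$$ be the Laguerre functions. For $\alpha>0$, $r>0$ let $X_{\alpha,r}$ be the Banach space of complex sequences $a=(a_n)_{n\in\mathbb N_0^d}$ with $\|a\|_{\alpha,r}=\sup_n |a_n|e^{r|n|^{1/\alpha}}<\infty$, where $|n|=n_1+\dots+n_d$. Let $\mathcal G_\alpha(\mathbb R^d_+)$ (resp. $\mathcal G_{0,\alpha}(\mathbb R^d_+)$) be the space of all functions $\sum_n a_n l_n$ on $\mathbb R^d_+$ with $(a_n)\in\bigcup_{r>0}X_{\alpha,r}$ (resp. $(a_n)\in\bigcap_{r>0}X_{\alpha,r}$), with the topology carried over, via $(a_n)\mapsto\sum_n a_nl_n$, from the locally convex inductive limit (resp. projective limit) topology of the sequence space; here $a_n=\int_{\mathbb R^d_+}f(x)l_n(x)\,dx$ if $f=\sum_n a_nl_n$.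 Let $I_0(\omega)=\sum_{k\ge 0}\frac{(\omega/2)^{2k}}{(k!)^2}$ and $J_0(s)=\sum_{k\ge 0}\frac{(-1)^k(s/2)^{2k}}{(k!)^2}$. For $z\in\mathbb C$ with $|z|=1$, $z\ne 1$, and $\mathbf z=(z,\dots,z)\in\mathbb C^d$, the fractional power of the Hankel–Clifford transform is $$\mathcal I_{\mathbf z,0}f(x)=(1-z)^{-d}\int_{\mathbb R^d_+}f(y)\prod_{j=1}^d e^{-\frac12\frac{1+z}{1-z}(x_j+y_j)}I_0\!\left(\frac{2\sqrt{x_jy_jz}}{1-z}\right)dy,\qquad x\in\mathbb R^d_+,$$ and the $d$-dimensional Hankel–Clifford transform is $$\mathscr H_0f(x)=2^{-d}\int_{\mathbb R^d_+}f(y)\prod_{j=1}^d J_0(\sqrt{x_jy_j})\,dy,\qquad x\in\mathbb R^d_+ .$$ Then for every $\alpha>0$ and every $z\in\mathbb C$ with $|z|=1$, $z\ne1$, the integral defining $\mathcal I_{\mathbf z,0}f(x)$ converges absolutely for all $f\in\mathcal G_{0,\alpha}(\mathbb R^d_+)\cup\mathcal G_\alpha(\mathbb R^d_+)$ and $x\in\mathbb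 R^d_+$, and $\mathcal I_{\mathbf z,0}$ is a topological isomorphism (a linear homeomorphism) of $\mathcal G_{0,\alpha}(\mathbb R^d_+)$ onto itself and of $\mathcal G_\alpha(\mathbb R^d_+)$ onto itself. The same holds for $\mathscr H_0$. -/

import Mathlib

open MeasureTheory
open scoped ENNReal

noncomputable section

namespace HankelClifford

/-! ### The orthant, Laguerre functions and Laguerre coefficients -/

/-- The open orthant `(0, ∞)^d`. -/
abbrev Orthant (d : ℕ) : Type := Fin d → Set.Ioi (0 : ℝ)

/-- Lebesgue measure on `(0, ∞)^d`: the product of the Lebesgue measures of the half-lines. -/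
def lebesgue (d : ℕ) : Measure (Orthant d) :=
  Measure.pi fun _ => Measure.comap (Subtype.val : Set.Ioi (0 : ℝ) → ℝ) volume

/-- The Laguerre polynomial `L_n` (of order zero), by the Rodrigues formula
`L_n(x) = (e^x / n!) (d/dx)^n (e^{-x} x^n)`. -/
def laguerrePoly (n : ℕ) (x : ℝ) : ℝ :=
  Real.exp x / (n.factorial : ℝ) * iteratedDeriv n (fun t : ℝ => Real.exp (-t) * t ^ n) x

/-- The `d`-dimensional Laguerre function `l_n(x) = ∏_j L_{n_j}(x_j) e^{-x_j/2}`. -/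
def laguerreFun {d : ℕ} (n : Fin d → ℕ) (x : Orthant d) : ℝ :=
  ∏ j, (laguerrePoly (n j) (x j : ℝ) * Real.exp (-(x j : ℝ) / 2))

/-- The Laguerre coefficient `a_n(f) = ∫ f(x) l_n(x) dx`. -/
def laguerreCoeff {d : ℕ} (f : Orthant d → ℂ) (n : Fin d → ℕ) : ℂ :=
  ∫ x, f x * (laguerreFun n x : ℂ) ∂(lebesgue d)

/-! ### Sequence spaces -/

/-- The weight `ϑ_{r,β}(n) = exp(r |n|^{1/(2β)})`, where `|n| = n_1 + ⋯ + n_d`. -/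
def weight (d : ℕ) (r β : ℝ) (n : Fin d → ℕ) : ℝ :=
  Real.exp (r * ((∑ j, n j : ℕ) : ℝ) ^ (1 / (2 * β)))

/-- The sequences `a` with `ϑ_{r,β} a` bounded. -/
def weightedSub (d : ℕ) (r β : ℝ) : Submodule ℂ ((Fin d → ℕ) → ℂ) where
  carrier := {a | Memℓp (fun n => (weight d r β n : ℂ) * a n) ∞}
  zero_mem' := by
    have h : Memℓp (fun _ : Fin d → ℕ => (0 : ℂ)) ∞ := zero_memℓp
    simpa using h
  add_mem' := by
    intro a b ha hb
    rw [Set.mem_ofPred_eq] at ha hb ⊢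
    convert Memℓp.add ha hb using 1
    funext n
    simp [mul_add]
  smul_mem' := by
    intro c a ha
    rw [Set.mem_ofPred_eq] at ha ⊢
    convert Memℓp.const_smul ha c using 1
    funext n
    simp [mul_left_comm]

/-- The Banach space `ℓ^∞_{[ϑ_{r,β}]}`. -/
def WeightedEll (d : ℕ) (r β : ℝ) : Type := weightedSub d r β

instance (d : ℕ) (r β : ℝ) : AddCommGroup (WeightedEll d r β) :=
  inferInstanceAs (AddCommGroup (weightedSub d r β))

instance (d : ℕ) (r β : ℝ) : Module ℂ (WeightedEll d r β) :=
  inferInstanceAs (Module ℂ (weightedSub d r β))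

/-- Multiplication by the weight, as a map into the unweighted `ℓ^∞`. -/
def mulWeight (d : ℕ) (r β : ℝ) :
    WeightedEll d r β →ₗ[ℂ] lp (fun _ : Fin d → ℕ => ℂ) ∞ where
  toFun a := ⟨fun n => (weight d r β n : ℂ) * a.1 n, a.2⟩
  map_add' a b := by
    ext n
    exact mul_add _ _ _
  map_smul' c a := by
    ext n
    exact mul_left_comm _ _ _

theorem mulWeight_injective (d : ℕ) (r β : ℝ) : Function.Injective (mulWeight d r β) := by
  intro a b h
  apply Subtype.ext
  funext n
  have hn : (weight d r β n : ℂ) * a.1 n = (weight d r β n : ℂ) * b.1 n :=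
    congrFun (congrArg Subtype.val h) n
  have hw : (weight d r β n : ℂ) ≠ 0 := by
    exact_mod_cast (Real.exp_pos _).ne'
  exact mul_left_cancel₀ hw hn

/-- The norm of `ℓ^∞_{[ϑ_{r,β}]}` is `‖a‖ = ‖ϑ_{r,β} a‖_{ℓ^∞}`. -/
instance (d : ℕ) (r β : ℝ) : NormedAddCommGroup (WeightedEll d r β) :=
  NormedAddCommGroup.induced _ _ (mulWeight d r β) (mulWeight_injective d r β)

theorem weightedSub_anti (d : ℕ) (β : ℝ) {r s : ℝ} (h : r ≤ s) :
    weightedSub d s β ≤ weightedSub d r β := by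
  intro a ha
  obtain ⟨C, hC⟩ := memℓp_infty_iff.mp ha
  refine memℓp_infty_iff.mpr ⟨C, ?_⟩
  rintro _ ⟨n, rfl⟩
  refine le_trans ?_ (hC ⟨n, rfl⟩)
  have hw : weight d r β n ≤ weight d s β n :=
    Real.exp_le_exp.mpr (mul_le_mul_of_nonneg_right h (by positivity))
  simp only [norm_mul, Complex.norm_real, Real.norm_eq_abs]
  rw [abs_of_pos (show 0 < weight d r β n from Real.exp_pos _),
    abs_of_pos (show 0 < weight d s β n from Real.exp_pos _)]
  exact mul_le_mul_of_nonneg_right hw (norm_nonneg _)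

/-- The sequences in `⋃_{r>0} ℓ^∞_{[ϑ_{r,β}]}`. -/
def roumieuSub (d : ℕ) (β : ℝ) : Submodule ℂ ((Fin d → ℕ) → ℂ) where
  carrier := {a | ∃ r : ℝ, 0 < r ∧ a ∈ weightedSub d r β}
  zero_mem' := ⟨1, one_pos, Submodule.zero_mem _⟩
  add_mem' := by
    rintro a b ⟨r, hr, ha⟩ ⟨s, hs, hb⟩
    exact ⟨min r s, lt_min hr hs, Submodule.add_mem _
      (weightedSub_anti d β (min_le_left r s) ha) (weightedSub_anti d β (min_le_right r s) hb)⟩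
  smul_mem' := by
    rintro c a ⟨r, hr, ha⟩
    exact ⟨r, hr, Submodule.smul_mem _ c ha⟩

/-- The sequences in `⋂_{r>0} ℓ^∞_{[ϑ_{r,β}]}`. -/
def beurlingSub (d : ℕ) (β : ℝ) : Submodule ℂ ((Fin d → ℕ) → ℂ) where
  carrier := {a | ∀ r : ℝ, 0 < r → a ∈ weightedSub d r β}
  zero_mem' := fun _ _ => Submodule.zero_mem _
  add_mem' := fun ha hb r hr => Submodule.add_mem _ (ha r hr) (hb r hr)
  smul_mem' := fun c _ ha r hr => Submodule.smul_mem _ c (ha r hr)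

/-- The space `ℓ_β(ℕ₀^d)`. -/
def RoumieuEll (d : ℕ) (β : ℝ) : Type := roumieuSub d β

instance (d : ℕ) (β : ℝ) : AddCommGroup (RoumieuEll d β) :=
  inferInstanceAs (AddCommGroup (roumieuSub d β))

instance (d : ℕ) (β : ℝ) : Module ℂ (RoumieuEll d β) :=
  inferInstanceAs (Module ℂ (roumieuSub d β))

/-- The inclusion `ℓ^∞_{[ϑ_{r,β}]} ⊆ ℓ_β`. -/
def toRoumieu (d : ℕ) (β : ℝ) {r : ℝ} (hr : 0 < r) (a : WeightedEll d r β) : RoumieuEll d β :=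
  ⟨a.1, r, hr, a.2⟩

/-- The (locally convex) inductive limit topology on `ℓ_β`: the finest locally convex vector
space topology for which all the inclusions of the Banach spaces `ℓ^∞_{[ϑ_{r,β}]}`, `r > 0`, are
continuous. (In the order on topologies, smaller means finer, and an infimum of vector
space topologies is again one.) -/
instance (d : ℕ) (β : ℝ) : TopologicalSpace (RoumieuEll d β) :=
  sInf {t : TopologicalSpace (RoumieuEll d β) |
    IsTopologicalAddGroup (RoumieuEll d β) ∧
    ContinuousSMul ℂ (RoumieuEll d β) ∧
    LocallyConvexSpace ℝ (RoumieuEll d β) ∧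
    ∀ (r : ℝ) (hr : 0 < r), @Continuous _ _ _ t (toRoumieu d β hr)}

/-- The space `ℓ_{0,β}(ℕ₀^d)`. -/
def BeurlingEll (d : ℕ) (β : ℝ) : Type := beurlingSub d β

instance (d : ℕ) (β : ℝ) : AddCommGroup (BeurlingEll d β) :=
  inferInstanceAs (AddCommGroup (beurlingSub d β))

instance (d : ℕ) (β : ℝ) : Module ℂ (BeurlingEll d β) :=
  inferInstanceAs (Module ℂ (beurlingSub d β))

/-- The inclusion `ℓ_{0,β} ⊆ ℓ^∞_{[ϑ_{r,β}]}`. -/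
def ofBeurling (d : ℕ) (β : ℝ) {r : ℝ} (hr : 0 < r) (a : BeurlingEll d β) : WeightedEll d r β :=
  ⟨a.1, a.2 r hr⟩

/-- The projective limit topology on `ℓ_{0,β}`: the coarsest topology for which all the
inclusions into the Banach spaces `ℓ^∞_{[ϑ_{r,β}]}`, `r > 0`, are continuous. -/
instance (d : ℕ) (β : ℝ) : TopologicalSpace (BeurlingEll d β) :=
  ⨅ (r : ℝ) (hr : 0 < r), TopologicalSpace.induced (ofBeurling d β hr) inferInstance

/-! ### The spaces of Laguerre series -/

/-- The functions on the orthant which are the sum of a Laguerre series `∑ a_n l_n` with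
coefficient sequence in `S`; the coefficients are those of the function. -/
def laguerreSeries (d : ℕ) (S : Submodule ℂ ((Fin d → ℕ) → ℂ)) :
    Submodule ℂ (Orthant d → ℂ) where
  carrier := {f |
    (∀ n, Integrable (fun x => f x * (laguerreFun n x : ℂ)) (lebesgue d)) ∧
    laguerreCoeff f ∈ S ∧
    ∀ x, HasSum (fun n => laguerreCoeff f n * (laguerreFun n x : ℂ)) (f x)}
  zero_mem' := by
    have h0 : laguerreCoeff (0 : Orthant d → ℂ) = 0 := by
      funext n
      simp [laguerreCoeff]
    refine ⟨fun n => by simp, ?_, fun x => ?_⟩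
    · rw [h0]
      exact S.zero_mem
    · simp [h0, hasSum_zero]
  add_mem' := by
    rintro f g ⟨hf, hfS, hfs⟩ ⟨hg, hgS, hgs⟩
    have hc : laguerreCoeff (f + g) = laguerreCoeff f + laguerreCoeff g := by
      funext n
      simp only [laguerreCoeff, Pi.add_apply, add_mul]
      exact integral_add (hf n) (hg n)
    refine ⟨fun n => ?_, ?_, fun x => ?_⟩
    · simp only [Pi.add_apply, add_mul]
      exact (hf n).add (hg n)
    · rw [hc]
      exact S.add_mem hfS hgS
    · simpa only [hc, Pi.add_apply, add_mul] using (hfs x).add (hgs x)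
  smul_mem' := by
    rintro c f ⟨hf, hfS, hfs⟩
    have hc : laguerreCoeff (c • f) = c • laguerreCoeff f := by
      funext n
      simp only [laguerreCoeff, Pi.smul_apply, smul_eq_mul, mul_assoc]
      exact integral_const_mul c _
    refine ⟨fun n => ?_, ?_, fun x => ?_⟩
    · simpa only [Pi.smul_apply, smul_eq_mul, mul_assoc] using (hf n).const_mul c
    · rw [hc]
      exact S.smul_mem c hfS
    · simpa only [hc, Pi.smul_apply, smul_eq_mul, mul_assoc] using (hfs x).mul_left c

/-- The space `𝒢_α(ℝ^d_+)` of Laguerre series with coefficients in `ℓ_{α/2}`. -/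
def RoumieuG (d : ℕ) (α : ℝ) : Type := laguerreSeries d (roumieuSub d (α / 2))

instance (d : ℕ) (α : ℝ) : AddCommGroup (RoumieuG d α) :=
  inferInstanceAs (AddCommGroup (laguerreSeries d (roumieuSub d (α / 2))))

instance (d : ℕ) (α : ℝ) : Module ℂ (RoumieuG d α) :=
  inferInstanceAs (Module ℂ (laguerreSeries d (roumieuSub d (α / 2))))

instance (d : ℕ) (α : ℝ) : CoeFun (RoumieuG d α) fun _ => Orthant d → ℂ := ⟨Subtype.val⟩

/-- The map `∑ a_n l_n ↦ (a_n)` from `𝒢_α` to `ℓ_{α/2}`. -/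
def RoumieuG.coeff {d : ℕ} {α : ℝ} (f : RoumieuG d α) : RoumieuEll d (α / 2) :=
  ⟨laguerreCoeff (f : Orthant d → ℂ), f.2.2.1⟩

/-- The topology of `𝒢_α` is inherited from `ℓ_{α/2}`. -/
instance (d : ℕ) (α : ℝ) : TopologicalSpace (RoumieuG d α) :=
  TopologicalSpace.induced RoumieuG.coeff inferInstance

/-- The space `𝒢_{0,α}(ℝ^d_+)` of Laguerre series with coefficients in `ℓ_{0,α/2}`. -/
def BeurlingG (d : ℕ) (α : ℝ) : Type := laguerreSeries d (beurlingSub d (α / 2))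

instance (d : ℕ) (α : ℝ) : AddCommGroup (BeurlingG d α) :=
  inferInstanceAs (AddCommGroup (laguerreSeries d (beurlingSub d (α / 2))))

instance (d : ℕ) (α : ℝ) : Module ℂ (BeurlingG d α) :=
  inferInstanceAs (Module ℂ (laguerreSeries d (beurlingSub d (α / 2))))

instance (d : ℕ) (α : ℝ) : CoeFun (BeurlingG d α) fun _ => Orthant d → ℂ := ⟨Subtype.val⟩

/-- The map `∑ a_n l_n ↦ (a_n)` from `𝒢_{0,α}` to `ℓ_{0,α/2}`. -/
def BeurlingG.coeff {d : ℕ} {α : ℝ} (f : BeurlingG d α) : BeurlingEll d (α / 2) :=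
  ⟨laguerreCoeff (f : Orthant d → ℂ), f.2.2.1⟩

/-- The topology of `𝒢_{0,α}` is inherited from `ℓ_{0,α/2}`. -/
instance (d : ℕ) (α : ℝ) : TopologicalSpace (BeurlingG d α) :=
  TopologicalSpace.induced BeurlingG.coeff inferInstance

/-! ### The transforms -/

/-- The modified Bessel function `I_0(ω) = ∑ (ω/2)^{2n} / (n!)²`. -/
def besselI0 (ω : ℂ) : ℂ := ∑' n : ℕ, (ω / 2) ^ (2 * n) / ((n.factorial : ℂ) ^ 2)

/-- The Bessel function `J_0(s) = ∑ (-1)^n (s/2)^{2n} / (n!)²`. -/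
def besselJ0 (s : ℝ) : ℝ := ∑' n : ℕ, (-1) ^ n * (s / 2) ^ (2 * n) / ((n.factorial : ℝ) ^ 2)

/-- `∏_j exp(-½ (1+z)/(1-z) (x_j + y_j)) I_0(2 √(x_j y_j z) / (1-z))`. The choice of the square
root does not matter, since `I_0` is even. -/
def fracKernel {d : ℕ} (z : ℂ) (x y : Orthant d) : ℂ :=
  ∏ j, (Complex.exp (-(1 / 2) * ((1 + z) / (1 - z)) * (((x j : ℝ) : ℂ) + ((y j : ℝ) : ℂ))) *
    besselI0 (2 * (((x j : ℝ) : ℂ) * ((y j : ℝ) : ℂ) * z) ^ (1 / 2 : ℂ) / (1 - z)))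

/-- The fractional power `ℐ_{(z,…,z),0}` of the Hankel–Clifford transform. -/
def fracHankelClifford {d : ℕ} (z : ℂ) (f : Orthant d → ℂ) (x : Orthant d) : ℂ :=
  ((1 - z) ^ d)⁻¹ * ∫ y, f y * fracKernel z x y ∂(lebesgue d)

/-- `∏_j J_0(√(x_j y_j))`. -/
def hankelKernel {d : ℕ} (x y : Orthant d) : ℝ :=
  ∏ j, besselJ0 (Real.sqrt ((x j : ℝ) * (y j : ℝ)))

/-- The `d`-dimensional Hankel–Clifford transform
`ℋ_0 f(x) = 2^{-d} ∫ f(y) ∏_j J_0(√(x_j y_j)) dy`. -/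
def hankelClifford {d : ℕ} (f : Orthant d → ℂ) (x : Orthant d) : ℂ :=
  ((2 : ℂ) ^ d)⁻¹ * ∫ y, f y * (hankelKernel x y : ℂ) ∂(lebesgue d)

end HankelClifford

end

open MeasureTheory
open scoped ENNReal

noncomputable section

namespace HankelClifford

/-! ### Binomial sums and the explicit Laguerre polynomials -/

/-! The Laguerre functions diagonalise the transform: `l_n` is an eigenfunction with eigenvalue
`z^{|n|}`. On coefficients the transform is therefore multiplication by a unimodular factor. This is
isometric on each weighted Banach space, so it is continuous for both limit topologies, and the
transform with parameter `z⁻¹` inverts it. The Hankel–Clifford transform is the case `z = -1`.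

The eigenvalue relation (`integral_laguerreFun₁_mul_fracKernel₁`) is a one-dimensional computation.
With `p = 1/(1-z)`, expand `I_0` in powers of `y` and integrate against `L_n(y) e^{-py}`. A
Vandermonde rearrangement writes these moments in powers of `1 - 1/p = z`, and summing over the
powers gives `z^n L_n(x)` times an exponential.

Applying the relation termwise to a series needs absolute bounds. For `|z| = 1` the exponential in
the kernel is unimodular and the Bessel factor is a value of `J_0` at a real point, so the kernel is
at most one (`norm_fracKernel₁_le_one`). The `L¹` norm of `l_n` grows polynomially
(`integral_abs_laguerreFun₁_le`), which the decay of the coefficients absorbs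
(`summable_norm_mul_prod_of_mem_roumieuSub`). Orthonormality then identifies the coefficients of the
image (`laguerreCoeff_fracHankelClifford`). -/

/-- Trinomial revision followed by the binomial theorem. At `u = -1` the right side vanishes unless
`j = n`, which is the source of orthogonality. -/
theorem sum_choose_mul_choose_mul_pow {R : Type*} [CommRing R] (n j : ℕ) (u : R) :
    ∑ m ∈ Finset.range (n + 1), (n.choose m : R) * (m.choose j : R) * u ^ m =
      (n.choose j : R) * u ^ j * (1 + u) ^ (n - j) := by
  rcases lt_or_ge n j with h | h
  · rw [Nat.choose_eq_zero_of_lt h]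
    simp only [Nat.cast_zero, zero_mul]
    refine Finset.sum_eq_zero fun m hm => ?_
    rw [Nat.choose_eq_zero_of_lt (n := m) (k := j) (by have := Finset.mem_range.mp hm; omega)]
    simp
  · obtain ⟨k, rfl⟩ := Nat.exists_eq_add_of_le h
    rw [show j + k + 1 = j + (k + 1) by ring, Finset.sum_range_add, Finset.sum_eq_zero, zero_add,
      show j + k - j = k by omega, add_comm (1 : R) u, add_pow, Finset.mul_sum]
    · refine Finset.sum_congr rfl fun i _ => ?_
      have := Nat.choose_mul (n := j + k) (k := j + i) (s := j) (by omega)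
      rw [show j + k - j = k by omega, show j + i - j = i by omega] at this
      rw [← Nat.cast_mul, this, pow_add]
      push_cast
      ring
    · intro m hm
      rw [Nat.choose_eq_zero_of_lt (n := m) (k := j) (Finset.mem_range.mp hm)]
      simp

theorem add_choose_eq_sum_choose_mul_choose (k m : ℕ) :
    (k + m).choose m = ∑ j ∈ Finset.range (m + 1), m.choose j * k.choose j := by
  rw [add_comm k m, Nat.add_choose_eq, Finset.Nat.sum_antidiagonal_eq_sum_range_succ_mk,
    ← Finset.sum_range_reflect]
  refine Finset.sum_congr rfl fun j hj => ?_
  have hj := Finset.mem_range.mp hj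
  simp only
  rw [show m + 1 - 1 - j = m - j by omega, show m - (m - j) = j by omega,
    Nat.choose_symm (by omega)]

/-- Vandermonde, then exchange of the two sums. It trades powers of `u` for powers of `1 + u`; with
`u = -1/p` and `p = 1/(1-z)` one has `1 + u = z`. -/
theorem sum_choose_mul_add_choose_mul_pow {R : Type*} [CommRing R] (n k : ℕ) (u : R) :
    ∑ m ∈ Finset.range (n + 1), (n.choose m : R) * ((k + m).choose m : R) * u ^ m =
      ∑ j ∈ Finset.range (n + 1),
        (n.choose j : R) * (k.choose j : R) * u ^ j * (1 + u) ^ (n - j) := by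
  have h (m : ℕ) (hm : m ∈ Finset.range (n + 1)) :
      (n.choose m : R) * ((k + m).choose m : R) * u ^ m =
      ∑ j ∈ Finset.range (n + 1),
        (k.choose j : R) * ((n.choose m : R) * (m.choose j : R) * u ^ m) := by
    rw [add_choose_eq_sum_choose_mul_choose, Finset.sum_subset (s₂ := Finset.range (n + 1))]
    · push_cast
      rw [Finset.mul_sum, Finset.sum_mul]
      refine Finset.sum_congr rfl fun j _ => ?_
      ring
    · intro j hj
      simp only [Finset.mem_range] at *
      omega
    · intro j _ hj
      rw [Nat.choose_eq_zero_of_lt (by simpa using hj), zero_mul]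
  rw [Finset.sum_congr rfl h, Finset.sum_comm]
  refine Finset.sum_congr rfl fun j _ => ?_
  rw [← Finset.mul_sum, sum_choose_mul_choose_mul_pow]
  ring

/-! ### Rodrigues' formula expanded, and the three-term recurrence. -/

theorem iteratedDeriv_exp_neg (n : ℕ) (x : ℝ) :
    iteratedDeriv n (fun t : ℝ => Real.exp (-t)) x = (-1) ^ n * Real.exp (-x) := by
  have := congrFun (iteratedDeriv_exp_const_mul n (-1)) x
  simpa using this

theorem laguerrePoly_eq_sum (n : ℕ) (x : ℝ) :
    laguerrePoly n x =
      ∑ m ∈ Finset.range (n + 1), (n.choose m : ℝ) * (-1) ^ m / (m.factorial : ℝ) * x ^ m := by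
  rw [laguerrePoly, iteratedDeriv_fun_mul (by fun_prop) (by fun_prop), Finset.mul_sum]
  refine Finset.sum_congr rfl fun m hm => ?_
  have hm : m ≤ n := by have := Finset.mem_range.mp hm; omega
  rw [iteratedDeriv_exp_neg, iteratedDeriv_pow, show n - (n - m) = m by omega]
  have h1 : (n.descFactorial (n - m) : ℝ) * m.factorial = n.factorial := by
    have := Nat.factorial_mul_descFactorial (n := n) (k := n - m) (by omega)
    rw [show n - (n - m) = m by omega] at this
    rw [mul_comm]
    exact_mod_cast this
  have h2 : Real.exp x * Real.exp (-x) = 1 := by rw [← Real.exp_add]; simp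
  have h3 : (m.factorial : ℝ) ≠ 0 := by positivity
  have h4 : (n.factorial : ℝ) ≠ 0 := by positivity
  field_simp
  rw [← h1]
  linear_combination (n.choose m : ℝ) * (n.descFactorial (n - m) : ℝ) * m.factorial
    * x ^ m * h2

theorem laguerrePoly_eq_sum_of_le {n N : ℕ} (h : n ≤ N) (x : ℝ) :
    laguerrePoly n x =
      ∑ m ∈ Finset.range (N + 1), (n.choose m : ℝ) * (-1) ^ m / (m.factorial : ℝ) * x ^ m := by
  rw [laguerrePoly_eq_sum]
  refine Finset.sum_subset (by simpa using h) fun m _ hm => ?_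
  rw [Nat.choose_eq_zero_of_lt (by simpa using hm)]
  simp

@[fun_prop]
theorem continuous_laguerrePoly (n : ℕ) : Continuous (laguerrePoly n) := by
  rw [funext (laguerrePoly_eq_sum n)]
  fun_prop

theorem laguerrePoly_zero (x : ℝ) : laguerrePoly 0 x = 1 := by
  simp [laguerrePoly_eq_sum]

theorem laguerrePoly_one (x : ℝ) : laguerrePoly 1 x = 1 - x := by
  simp [laguerrePoly_eq_sum, Finset.sum_range_succ]
  ring

/-- The three-term recurrence of the Laguerre polynomials. -/
theorem mul_laguerrePoly_succ (n : ℕ) (x : ℝ) :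
    x * laguerrePoly (n + 1) x =
      (2 * n + 3) * laguerrePoly (n + 1) x - (n + 2) * laguerrePoly (n + 2) x
        - (n + 1) * laguerrePoly n x := by
  have hx : x * laguerrePoly (n + 1) x = ∑ m ∈ Finset.range (n + 2),
      ((n + 1).choose m : ℝ) * (-1) ^ m / (m.factorial : ℝ) * x ^ (m + 1) := by
    rw [laguerrePoly_eq_sum, Finset.mul_sum]
    refine Finset.sum_congr rfl fun m _ => ?_
    ring
  -- All sums on the right are padded to the same range; peeling off the constant term then aligns
  -- them with the shifted powers on the left.
  rw [hx, laguerrePoly_eq_sum_of_le (show n + 1 ≤ n + 2 by omega), laguerrePoly_eq_sum (n + 2),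
    laguerrePoly_eq_sum_of_le (show n ≤ n + 2 by omega), Finset.mul_sum, Finset.mul_sum,
    Finset.mul_sum, ← Finset.sum_sub_distrib, ← Finset.sum_sub_distrib, Finset.sum_range_succ' _ (n + 2)]
  rw [← sub_eq_zero, ← sub_sub, ← Finset.sum_sub_distrib]
  rw [Finset.sum_eq_zero]
  · simp
    ring
  intro m _
  -- Absorption and Pascal's rule reduce the coefficient of `x^(m+1)` to a polynomial identity.
  have h1 : (((n + 1) + 1).choose (m + 1) : ℝ) * (m + 1) = ((n + 1 : ℕ) + 1) * (n + 1).choose m := by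
    exact_mod_cast (Nat.add_one_mul_choose_eq (n + 1) m).symm
  have h2 : ((n + 1).choose (m + 1) : ℝ) * (m + 1) = (n + 1) * n.choose m := by
    exact_mod_cast (Nat.add_one_mul_choose_eq n m).symm
  have h3 : ((n + 1).choose (m + 1) : ℝ) = n.choose m + n.choose (m + 1) := by
    exact_mod_cast Nat.choose_succ_succ n m
  have h4 : ((n + 2).choose (m + 1) : ℝ) = (n + 1).choose m + (n + 1).choose (m + 1) := by
    exact_mod_cast Nat.choose_succ_succ (n + 1) m
  have h5 : (m.factorial : ℝ) ≠ 0 := by positivity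
  have h6 : ((m : ℝ) + 1) ≠ 0 := by positivity
  rw [Nat.factorial_succ]
  push_cast at *
  field_simp
  rw [h4] at h1 ⊢
  linear_combination x ^ (m + 1) * (-1) ^ m * (h1 - h2 + (n + 1) * h3)

/-! ### Integrals over the half-line -/

/-- Lebesgue measure on `(0, ∞)`. -/
abbrev halfLine : Measure (Set.Ioi (0 : ℝ)) :=
  Measure.comap (Subtype.val : Set.Ioi (0 : ℝ) → ℝ) volume

instance : SigmaFinite halfLine :=
  SigmaFinite.of_map _ measurable_subtype_coe.aemeasurable (by
    rw [map_comap_subtype_coe measurableSet_Ioi]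
    infer_instance)

theorem integrable_halfLine_iff {E : Type*} [NormedAddCommGroup E] {f : ℝ → E} :
    Integrable (fun y : Set.Ioi (0 : ℝ) => f y) halfLine ↔ IntegrableOn f (Set.Ioi 0) :=
  (integrableOn_iff_comap_subtypeVal measurableSet_Ioi).symm

theorem integrableOn_pow_mul_exp (k : ℕ) {b : ℝ} (hb : 0 < b) :
    IntegrableOn (fun y : ℝ => y ^ k * Real.exp (-b * y)) (Set.Ioi 0) := by
  have := integrableOn_rpow_mul_exp_neg_mul_rpow (p := 1) (s := k) (b := b)
    (by have : (0 : ℝ) ≤ k := by positivity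
        linarith) one_pos hb
  simpa using this

theorem integrableOn_pow_mul_cexp (k : ℕ) {p : ℂ} (hp : 0 < p.re) :
    IntegrableOn (fun y : ℝ => (y : ℂ) ^ k * Complex.exp (-p * y)) (Set.Ioi 0) := by
  refine Integrable.mono' (integrableOn_pow_mul_exp k hp)
    (Continuous.aestronglyMeasurable (by fun_prop)) ?_
  filter_upwards [ae_restrict_mem measurableSet_Ioi] with y hy
  rw [norm_mul, norm_pow, Complex.norm_real, Complex.norm_exp, Real.norm_of_nonneg (le_of_lt hy)]
  simp

/-- Induction on `k` by integration by parts, which covers complex rates directly. -/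
theorem integral_pow_mul_cexp (k : ℕ) {p : ℂ} (hp : 0 < p.re) :
    ∫ y in Set.Ioi (0 : ℝ), (y : ℂ) ^ k * Complex.exp (-p * y) =
      (k.factorial : ℂ) / p ^ (k + 1) := by
  have hp0 : p ≠ 0 := by
    rintro rfl
    simp at hp
  have lim (k : ℕ) : Filter.Tendsto (fun y : ℝ => (y : ℂ) ^ k * Complex.exp (-p * y)) Filter.atTop
      (nhds 0) := by
    rw [tendsto_zero_iff_norm_tendsto_zero]
    have := tendsto_rpow_mul_exp_neg_mul_atTop_nhds_zero k p.re hp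
    refine this.congr' ?_
    filter_upwards [Filter.eventually_ge_atTop 0] with y hy
    rw [norm_mul, norm_pow, Complex.norm_real, Complex.norm_exp, Real.norm_of_nonneg hy]
    simp
  have hd (y : ℝ) : HasDerivAt (fun y : ℝ => Complex.exp (-p * y)) (Complex.exp (-p * y) * (-p)) y := by
    have h1 : HasDerivAt (fun y : ℝ => (y : ℂ)) 1 y := Complex.ofRealCLM.hasDerivAt
    simpa using (h1.const_mul (-p)).cexp
  have h0 (y : ℝ) : HasDerivAt (fun y : ℝ => (y : ℂ)) 1 y := Complex.ofRealCLM.hasDerivAt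
  induction k with
  | zero =>
    have := integral_Ioi_of_hasDerivAt_of_tendsto (a := 0)
      (f := fun y : ℝ => -(1 / p) * Complex.exp (-p * y))
      (f' := fun y : ℝ => (y : ℂ) ^ 0 * Complex.exp (-p * y)) (m := 0)
      (by fun_prop) (fun y _ => ?_) (integrableOn_pow_mul_cexp 0 hp) ?_
    · rw [this]
      simp
    · refine ((hd y).const_mul (-(1 / p))).congr_deriv ?_
      rw [pow_zero]
      field_simp
    · simpa using (lim 0).const_mul (-(1 / p))
  | succ k ih =>
    -- The derivative of `y^(k+1) e^{-py}` has integral zero, since both boundary values vanish;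
    -- this is the recursion in `k`.
    have := integral_Ioi_of_hasDerivAt_of_tendsto (a := 0)
      (f := fun y : ℝ => (y : ℂ) ^ (k + 1) * Complex.exp (-p * y))
      (f' := fun y : ℝ => ((k : ℂ) + 1) * ((y : ℂ) ^ k * Complex.exp (-p * y)) -
        p * ((y : ℂ) ^ (k + 1) * Complex.exp (-p * y))) (m := 0)
      (by fun_prop) (fun y _ => ?_) (((integrableOn_pow_mul_cexp k hp).const_mul _).sub
        ((integrableOn_pow_mul_cexp (k + 1) hp).const_mul _)) ?_
    · rw [integral_sub ((integrableOn_pow_mul_cexp k hp).const_mul _)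
        ((integrableOn_pow_mul_cexp (k + 1) hp).const_mul _), integral_const_mul,
        integral_const_mul, ih] at this
      have h2 : p * ∫ y in Set.Ioi (0 : ℝ), (y : ℂ) ^ (k + 1) * Complex.exp (-p * y) =
          ((k : ℂ) + 1) * ((k.factorial : ℂ) / p ^ (k + 1)) := by
        simp only [Complex.ofReal_zero, ne_eq, Nat.add_eq_zero_iff, one_ne_zero, and_false,
          not_false_eq_true, zero_pow, zero_mul, sub_zero] at this
        linear_combination -this
      rw [← mul_right_inj' hp0, h2, Nat.factorial_succ]
      push_cast
      field_simp
      ring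
    · refine (((h0 y).pow (k + 1)).mul (hd y)).congr_deriv ?_
      push_cast
      simp only [Pi.pow_apply]
      ring
    · exact lim (k + 1)

/-! ### Moments of Laguerre polynomials and orthonormality. -/

theorem laguerrePoly_ofReal (n : ℕ) (y : ℝ) :
    ((laguerrePoly n y : ℝ) : ℂ) =
      ∑ m ∈ Finset.range (n + 1), (n.choose m : ℂ) * (-1) ^ m / (m.factorial : ℂ) * (y : ℂ) ^ m := by
  rw [laguerrePoly_eq_sum]
  push_cast
  rfl

theorem pow_mul_laguerrePoly_mul_cexp (k n : ℕ) (p : ℂ) (y : ℝ) :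
    (y : ℂ) ^ k * (laguerrePoly n y : ℂ) * Complex.exp (-p * y) =
      ∑ m ∈ Finset.range (n + 1), (n.choose m : ℂ) * (-1) ^ m / (m.factorial : ℂ) *
        ((y : ℂ) ^ (k + m) * Complex.exp (-p * y)) := by
  rw [laguerrePoly_ofReal, Finset.mul_sum, Finset.sum_mul]
  refine Finset.sum_congr rfl fun m _ => ?_
  ring

theorem integrableOn_pow_mul_laguerrePoly_mul_cexp (k n : ℕ) {p : ℂ} (hp : 0 < p.re) :
    IntegrableOn (fun y : ℝ => (y : ℂ) ^ k * (laguerrePoly n y : ℂ) * Complex.exp (-p * y))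
      (Set.Ioi 0) := by
  simp only [pow_mul_laguerrePoly_mul_cexp]
  exact integrable_finsetSum _ fun m _ => (integrableOn_pow_mul_cexp (k + m) hp).const_mul _

theorem integral_pow_mul_laguerrePoly_mul_cexp (k n : ℕ) {p : ℂ} (hp : 0 < p.re) :
    ∫ y in Set.Ioi (0 : ℝ), (y : ℂ) ^ k * (laguerrePoly n y : ℂ) * Complex.exp (-p * y) =
      (k.factorial : ℂ) / p ^ (k + 1) * ∑ m ∈ Finset.range (n + 1),
        (n.choose m : ℂ) * ((k + m).choose m : ℂ) * (-1 / p) ^ m := by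
  have hp0 : p ≠ 0 := by
    rintro rfl
    simp at hp
  simp only [pow_mul_laguerrePoly_mul_cexp]
  rw [integral_finsetSum _ fun m _ => (integrableOn_pow_mul_cexp (k + m) hp).const_mul _,
    Finset.mul_sum]
  refine Finset.sum_congr rfl fun m _ => ?_
  rw [integral_const_mul, integral_pow_mul_cexp _ hp]
  have h : (((k + m).choose m : ℕ) : ℂ) * (k.factorial * m.factorial) = (k + m).factorial := by
    rw [add_comm k m, mul_comm (k.factorial : ℂ), ← mul_assoc]
    rw [Nat.choose_symm_add]
    exact_mod_cast Nat.add_choose_mul_factorial_mul_factorial m k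
  have hm : (m.factorial : ℂ) ≠ 0 := by exact_mod_cast m.factorial_ne_zero
  rw [← h, div_pow]
  field_simp
  ring

/-- Here `p = 1`, so `1 + u = 0` and only `j = n` survives; moments of order below `n` vanish. -/
theorem integral_pow_mul_laguerrePoly_mul_exp_neg (k n : ℕ) :
    ∫ y in Set.Ioi (0 : ℝ), (y : ℂ) ^ k * (laguerrePoly n y : ℂ) * Complex.exp (-1 * y) =
      (k.factorial : ℂ) * (-1) ^ n * (k.choose n : ℂ) := by
  rw [integral_pow_mul_laguerrePoly_mul_cexp k n (by simp), sum_choose_mul_add_choose_mul_pow,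
    Finset.sum_eq_single n]
  · simp
    ring
  · intro j hj hjn
    have := Finset.mem_range.mp hj
    rw [div_one, add_neg_cancel, zero_pow (by omega), mul_zero]
  · simp

/-- The one-dimensional Laguerre function. -/
def laguerreFun₁ (n : ℕ) (y : ℝ) : ℝ := laguerrePoly n y * Real.exp (-y / 2)

theorem continuous_laguerreFun₁ (n : ℕ) : Continuous (laguerreFun₁ n) := by
  unfold laguerreFun₁
  fun_prop

theorem laguerreFun₁_mul_ofReal (n m : ℕ) (y : ℝ) :
    (laguerreFun₁ n y : ℂ) * (laguerreFun₁ m y : ℂ) =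
      ∑ i ∈ Finset.range (m + 1), (m.choose i : ℂ) * (-1) ^ i / (i.factorial : ℂ) *
        ((y : ℂ) ^ i * (laguerrePoly n y : ℂ) * Complex.exp (-1 * y)) := by
  have h : Complex.exp (-1 * y) = Complex.exp (-y / 2) * Complex.exp (-y / 2) := by
    rw [← Complex.exp_add]
    ring_nf
  simp only [laguerreFun₁, Complex.ofReal_mul, laguerrePoly_ofReal m, h]
  push_cast
  rw [Finset.sum_mul, Finset.mul_sum]
  refine Finset.sum_congr rfl fun i _ => ?_
  ring

theorem integrableOn_laguerreFun₁_mul_ofReal (n m : ℕ) :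
    IntegrableOn (fun y : ℝ => (laguerreFun₁ n y : ℂ) * (laguerreFun₁ m y : ℂ)) (Set.Ioi 0) := by
  simp only [laguerreFun₁_mul_ofReal]
  exact integrable_finsetSum _ fun i _ =>
    (integrableOn_pow_mul_laguerrePoly_mul_cexp i n (by simp)).const_mul _

/-- The Laguerre functions are orthonormal. -/
theorem integral_laguerreFun₁_mul_ofReal (n m : ℕ) :
    ∫ y in Set.Ioi (0 : ℝ), (laguerreFun₁ n y : ℂ) * (laguerreFun₁ m y : ℂ) =
      if n = m then 1 else 0 := by
  simp only [laguerreFun₁_mul_ofReal]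
  rw [integral_finsetSum _ fun i _ =>
    (integrableOn_pow_mul_laguerrePoly_mul_cexp i n (by simp)).const_mul _]
  have h (i : ℕ) : ∫ y in Set.Ioi (0 : ℝ), (m.choose i : ℂ) * (-1) ^ i / (i.factorial : ℂ) *
      ((y : ℂ) ^ i * (laguerrePoly n y : ℂ) * Complex.exp (-1 * y)) =
      (-1) ^ n * ((m.choose i : ℂ) * (i.choose n : ℂ) * (-1) ^ i) := by
    rw [integral_const_mul, integral_pow_mul_laguerrePoly_mul_exp_neg]
    have : (i.factorial : ℂ) ≠ 0 := by exact_mod_cast i.factorial_ne_zero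
    field_simp
  simp only [h]
  rw [← Finset.mul_sum, sum_choose_mul_choose_mul_pow, add_neg_cancel]
  split_ifs with hnm
  · subst hnm
    simp [← mul_pow]
  -- For `n < m` the factor `0^(m-n)` vanishes; for `n > m` the binomial coefficient does.
  · rcases lt_or_gt_of_ne hnm with hj | hj
    · rw [zero_pow (by omega)]
      simp
    · rw [Nat.choose_eq_zero_of_lt hj]
      simp

theorem integrableOn_laguerreFun₁_mul (n m : ℕ) :
    IntegrableOn (fun y : ℝ => laguerreFun₁ n y * laguerreFun₁ m y) (Set.Ioi 0) := by
  have := (integrableOn_laguerreFun₁_mul_ofReal n m).re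
  refine this.congr (Filter.Eventually.of_forall fun y => ?_)
  simp [← Complex.ofReal_mul]

theorem integral_laguerreFun₁_sq (n : ℕ) :
    ∫ y in Set.Ioi (0 : ℝ), laguerreFun₁ n y ^ 2 = 1 := by
  have h := integral_laguerreFun₁_mul_ofReal n n
  simp only [← Complex.ofReal_mul, integral_complex_ofReal] at h
  simp only [pow_two]
  rw [if_pos trivial] at h
  exact_mod_cast h

/-! ### Polynomial growth of the `L¹` norms. -/

theorem mul_laguerreFun₁_succ (n : ℕ) (x : ℝ) :
    x * laguerreFun₁ (n + 1) x =
      (2 * n + 3) * laguerreFun₁ (n + 1) x - (n + 2) * laguerreFun₁ (n + 2) x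
        - (n + 1) * laguerreFun₁ n x := by
  simp only [laguerreFun₁]
  linear_combination Real.exp (-x / 2) * mul_laguerrePoly_succ n x

/-- Uniform control of `(1 + y) l_n(y)` by neighbouring Laguerre functions. -/
theorem one_add_mul_laguerreFun₁_sq_le (n : ℕ) :
    ∃ m, ∀ y : ℝ, ((1 + y) * laguerreFun₁ n y) ^ 2 ≤ 48 * ((n : ℝ) + 1) ^ 2 *
      (laguerreFun₁ n y ^ 2 + laguerreFun₁ (n + 1) y ^ 2 + laguerreFun₁ m y ^ 2) := by
  cases n with
  | zero =>
    -- There is no lower neighbour here, so `m = 0` is only a filler.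
    refine ⟨0, fun y => ?_⟩
    have h : (1 + y) * laguerreFun₁ 0 y = 2 * laguerreFun₁ 0 y - laguerreFun₁ 1 y := by
      simp only [laguerreFun₁, laguerrePoly_zero, laguerrePoly_one]
      ring
    rw [h]
    norm_num
    nlinarith [sq_nonneg (2 * laguerreFun₁ 0 y + laguerreFun₁ 1 y), sq_nonneg (laguerreFun₁ 0 y),
      sq_nonneg (laguerreFun₁ 1 y)]
  | succ n =>
    refine ⟨n, fun y => ?_⟩
    have h : (1 + y) * laguerreFun₁ (n + 1) y = (2 * n + 4) * laguerreFun₁ (n + 1) y -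
        (n + 2) * laguerreFun₁ (n + 2) y - (n + 1) * laguerreFun₁ n y := by
      linear_combination mul_laguerreFun₁_succ n y
    rw [h]
    set a := laguerreFun₁ (n + 1) y
    set b := laguerreFun₁ (n + 2) y
    set c := laguerreFun₁ n y
    have hn : (0 : ℝ) ≤ n := by positivity
    -- The constant is `48 = 3 · 16`: Cauchy–Schwarz for three terms, and each recurrence
    -- coefficient is at most `4(n+2)`.
    have key (u v w : ℝ) : (u - v - w) ^ 2 ≤ 3 * (u ^ 2 + v ^ 2 + w ^ 2) := by
      nlinarith [sq_nonneg (u + v), sq_nonneg (u + w), sq_nonneg (v - w)]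
    refine (key _ _ _).trans ?_
    push_cast
    have h1 : ((2 * n + 4) * a) ^ 2 ≤ 16 * (((n : ℝ) + 1 + 1) ^ 2 * a ^ 2) := by
      rw [mul_pow, ← mul_assoc]
      gcongr
      nlinarith
    have h2 : ((n + 2) * b) ^ 2 ≤ 16 * (((n : ℝ) + 1 + 1) ^ 2 * b ^ 2) := by
      rw [mul_pow, ← mul_assoc]
      gcongr
      nlinarith
    have h3 : ((n + 1) * c) ^ 2 ≤ 16 * (((n : ℝ) + 1 + 1) ^ 2 * c ^ 2) := by
      rw [mul_pow, ← mul_assoc]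
      gcongr
      nlinarith
    linarith

theorem integrableOn_laguerreFun₁ (n : ℕ) : IntegrableOn (laguerreFun₁ n) (Set.Ioi 0) := by
  have h := (integrableOn_pow_mul_laguerrePoly_mul_cexp 0 n (p := 1 / 2) (by norm_num)).re
  refine h.congr (Filter.Eventually.of_forall fun y => ?_)
  have : Complex.exp (-(1 / 2) * y) = (Real.exp (-y / 2) : ℂ) := by
    push_cast
    ring_nf
  simp only [this, pow_zero, one_mul, ← Complex.ofReal_mul, laguerreFun₁]
  exact Complex.ofReal_re _

/-- Split `l_n = (1+y)⁻¹ · (1+y) l_n` and apply the inequality of arithmetic and geometric means.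
The first square is integrable; the second is controlled by neighbouring Laguerre functions, whose
`L²` norms are one. -/
theorem integral_abs_laguerreFun₁_le (n : ℕ) :
    ∫ y in Set.Ioi (0 : ℝ), |laguerreFun₁ n y| ≤ 73 * ((n : ℝ) + 1) ^ 2 := by
  obtain ⟨m, hm⟩ := one_add_mul_laguerreFun₁_sq_le n
  have hsq (k : ℕ) : IntegrableOn (fun y => laguerreFun₁ k y ^ 2) (Set.Ioi 0) := by
    simpa only [pow_two] using integrableOn_laguerreFun₁_mul k k
  have hdec : IntegrableOn (fun y : ℝ => (1 + y ^ 2)⁻¹) (Set.Ioi 0) :=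
    integrable_inv_one_add_sq.integrableOn
  have hdec' : ∫ y in Set.Ioi (0 : ℝ), (1 + y ^ 2)⁻¹ ≤ 2 := by
    rw [integral_Ioi_inv_one_add_sq]
    simp
    linarith [Real.pi_le_four]
  have hle : ∫ y in Set.Ioi (0 : ℝ), |laguerreFun₁ n y| ≤ ∫ y in Set.Ioi (0 : ℝ),
      (24 * ((n : ℝ) + 1) ^ 2 *
      (laguerreFun₁ n y ^ 2 + laguerreFun₁ (n + 1) y ^ 2 + laguerreFun₁ m y ^ 2) +
        1 / 2 * (1 + y ^ 2)⁻¹) := by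
    refine setIntegral_mono_on (integrableOn_laguerreFun₁ n).abs
      (((((hsq n).add (hsq (n + 1))).add (hsq m)).const_mul _).add (hdec.const_mul _))
      measurableSet_Ioi fun y hy => ?_
    have hy : 0 < y := hy
    have h1 := hm y
    have h2 : (1 + y)⁻¹ ^ 2 ≤ (1 + y ^ 2)⁻¹ := by
      rw [inv_pow]
      apply inv_anti₀ (by positivity)
      nlinarith
    have h3 : |laguerreFun₁ n y| = (1 + y)⁻¹ * |(1 + y) * laguerreFun₁ n y| := by
      rw [abs_mul, abs_of_pos (show 0 < 1 + y by linarith), ← mul_assoc, inv_mul_cancel₀ (by linarith),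
        one_mul]
    rw [h3]
    have h4 := sq_abs ((1 + y) * laguerreFun₁ n y)
    nlinarith [sq_nonneg ((1 + y)⁻¹ - |(1 + y) * laguerreFun₁ n y|)]
  refine hle.trans ?_
  have hsum : IntegrableOn (fun y => laguerreFun₁ n y ^ 2 + laguerreFun₁ (n + 1) y ^ 2)
      (Set.Ioi 0) := (hsq n).add (hsq (n + 1))
  have hsum' : IntegrableOn (fun y => laguerreFun₁ n y ^ 2 + laguerreFun₁ (n + 1) y ^ 2 +
      laguerreFun₁ m y ^ 2) (Set.Ioi 0) := hsum.add (hsq m)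
  rw [integral_add (hsum'.const_mul _) (hdec.const_mul _),
    integral_const_mul, integral_const_mul, integral_add hsum (hsq m),
    integral_add (hsq n) (hsq (n + 1)), integral_laguerreFun₁_sq, integral_laguerreFun₁_sq,
    integral_laguerreFun₁_sq]
  -- The total is at most `24 (n+1)² · 3 + ½ · 2`, hence the constant `73`.
  nlinarith [show (0 : ℝ) ≤ n by positivity]

/-! ### The Bessel function `J_0` is continuous and bounded by one -/

theorem prod_odd_div_even (n : ℕ) :
    ∏ i ∈ Finset.range n, (2 * (i : ℝ) + 1) / (2 * i + 2) =
      ((2 * n).factorial : ℝ) / (4 ^ n * (n.factorial : ℝ) ^ 2) := by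
  induction n with
  | zero => simp
  | succ n ih =>
    rw [Finset.prod_range_succ, ih, show 2 * (n + 1) = 2 * n + 1 + 1 by ring, Nat.factorial_succ,
      Nat.factorial_succ, Nat.factorial_succ]
    have : (n.factorial : ℝ) ≠ 0 := by positivity
    push_cast
    field_simp
    ring

/-- Termwise integration of the cosine series, dominated by the series of `cosh s`; the integrals of
`sin^{2n}` are Wallis products. So `J_0` is an average of cosines, from which continuity and the
bound by one follow. -/
theorem hasSum_integral_cos_mul_sin (s : ℝ) :
    HasSum (fun n : ℕ => Real.pi * ((-1) ^ n * (s / 2) ^ (2 * n) / ((n.factorial : ℝ) ^ 2)))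
      (∫ θ in (0 : ℝ)..Real.pi, Real.cos (s * Real.sin θ)) := by
  have h := intervalIntegral.hasSum_integral_of_dominated_convergence (μ := volume)
    (a := 0) (b := Real.pi)
    (F := fun (n : ℕ) θ => (-1) ^ n * (s * Real.sin θ) ^ (2 * n) / ((2 * n).factorial : ℝ))
    (f := fun θ => Real.cos (s * Real.sin θ))
    (fun (n : ℕ) _ => s ^ (2 * n) / ((2 * n).factorial : ℝ))
    (fun n => Continuous.aestronglyMeasurable (by fun_prop))
    (fun n => Filter.Eventually.of_forall fun θ _ => ?_)
    (Filter.Eventually.of_forall fun θ _ => (Real.hasSum_cosh s).summable)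
    intervalIntegrable_const
    (Filter.Eventually.of_forall fun θ _ => Real.hasSum_cos _)
  · convert! h using 2 with n
    simp only [mul_pow, mul_div_assoc]
    have h2 (θ : ℝ) : (-1 : ℝ) ^ n * (s ^ (2 * n) * (Real.sin θ ^ (2 * n) / ((2 * n).factorial : ℝ)))
        = ((-1) ^ n * s ^ (2 * n) / ((2 * n).factorial : ℝ)) * Real.sin θ ^ (2 * n) := by ring
    simp only [h2]
    rw [intervalIntegral.integral_const_mul, integral_sin_pow_even, prod_odd_div_even, div_pow,
      pow_mul 2 2 n]
    have h3 : ((2 * n).factorial : ℝ) ≠ 0 := by positivity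
    have h4 : (n.factorial : ℝ) ≠ 0 := by positivity
    norm_num
    field_simp
  · rw [norm_div, norm_mul, norm_pow, norm_neg, norm_one, one_pow, one_mul,
      Real.norm_of_nonneg (by positivity : (0 : ℝ) ≤ ((2 * n).factorial : ℝ)),
      Real.norm_of_nonneg ((even_two_mul n).pow_nonneg _), mul_pow]
    gcongr
    refine mul_le_of_le_one_right ((even_two_mul n).pow_nonneg _) ?_
    rw [pow_mul]
    exact pow_le_one₀ (sq_nonneg _) (Real.sin_sq_le_one θ)

theorem pi_mul_besselJ0 (s : ℝ) :
    Real.pi * besselJ0 s = ∫ θ in (0 : ℝ)..Real.pi, Real.cos (s * Real.sin θ) := by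
  rw [← (hasSum_integral_cos_mul_sin s).tsum_eq, tsum_mul_left, besselJ0]

theorem besselJ0_eq_integral (s : ℝ) :
    besselJ0 s = Real.pi⁻¹ * ∫ θ in (0 : ℝ)..Real.pi, Real.cos (s * Real.sin θ) := by
  rw [← pi_mul_besselJ0, inv_mul_cancel_left₀ Real.pi_ne_zero]

@[fun_prop]
theorem continuous_besselJ0 : Continuous besselJ0 := by
  rw [funext besselJ0_eq_integral]
  refine continuous_const.mul ?_
  exact intervalIntegral.continuous_parametric_intervalIntegral_of_continuous' (by fun_prop) _ _

theorem abs_besselJ0_le_one (s : ℝ) : |besselJ0 s| ≤ 1 := by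
  have h := intervalIntegral.norm_integral_le_of_norm_le_const (a := 0) (b := Real.pi) (C := 1)
    (f := fun θ => Real.cos (s * Real.sin θ)) (fun θ _ => Real.abs_cos_le_one _)
  rw [← pi_mul_besselJ0, norm_mul, sub_zero, one_mul, Real.norm_eq_abs, Real.norm_eq_abs] at h
  exact le_of_mul_le_mul_left (by simpa using h) (abs_pos.mpr Real.pi_ne_zero)

/-! ### The one-dimensional kernel -/

/-- The one-dimensional kernel of the fractional Hankel–Clifford transform. -/
def fracKernel₁ (z : ℂ) (x y : ℝ) : ℂ :=
  Complex.exp (-(1 / 2) * ((1 + z) / (1 - z)) * ((x : ℂ) + (y : ℂ))) *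
    besselI0 (2 * ((x : ℂ) * (y : ℂ) * z) ^ (1 / 2 : ℂ) / (1 - z))

/-- Only even powers of the root occur, so the branch disappears. -/
theorem besselI0_two_mul_cpow_half_div (w c : ℂ) :
    besselI0 (2 * w ^ (1 / 2 : ℂ) / c) =
      ∑' k : ℕ, (w / c ^ 2) ^ k / ((k.factorial : ℂ) ^ 2) := by
  have h : (w ^ (1 / 2 : ℂ)) ^ 2 = w := by
    rw [one_div]
    exact_mod_cast Complex.cpow_nat_inv_pow w two_ne_zero
  unfold besselI0
  refine tsum_congr fun k => ?_
  rw [pow_mul, mul_div_assoc, mul_div_cancel_left₀ _ two_ne_zero, div_pow, h]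

/-- On the unit circle the conjugate of `z` is `1/z`, so `|1-z|² = (1-z)(1-1/z)`. -/
theorem one_sub_mul_conj {z : ℂ} (hz : ‖z‖ = 1) : (1 - z) ^ 2 = -(‖1 - z‖ : ℂ) ^ 2 * z := by
  have h1 := Complex.mul_conj' (1 - z)
  have h2 := Complex.mul_conj' z
  rw [hz, map_sub, map_one] at *
  rw [← h1]
  push_cast at h2
  linear_combination (z - 1) * h2

/-- This ratio is a negative real, which is what turns `I_0` into `J_0` at a real argument. -/
theorem div_one_sub_sq {z : ℂ} (hz : ‖z‖ = 1) (hz1 : z ≠ 1) :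
    z / (1 - z) ^ 2 = -((1 / ‖1 - z‖ ^ 2 : ℝ) : ℂ) := by
  have h0 : z ≠ 0 := by
    rintro rfl
    simp at hz
  have h1 : (‖1 - z‖ : ℂ) ≠ 0 := by
    exact_mod_cast norm_ne_zero_iff.mpr (sub_ne_zero.mpr hz1.symm)
  rw [one_sub_mul_conj hz]
  push_cast
  field_simp

/-- The map `z ↦ 1/(1-z)` sends the unit circle to this vertical line. Hence `e^{-py}` decays like
`e^{-y/2}`, and `(1+z)/(1-z) = 2p - 1` is purely imaginary. -/
theorem re_inv_one_sub {z : ℂ} (hz : ‖z‖ = 1) (hz1 : z ≠ 1) : ((1 - z)⁻¹).re = 1 / 2 := by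
  have h : Complex.normSq z = 1 := by rw [Complex.normSq_eq_norm_sq, hz, one_pow]
  have h1 : Complex.normSq (1 - z) ≠ 0 := by
    simpa [sub_eq_zero] using hz1.symm
  rw [Complex.inv_re, div_eq_div_iff h1 two_ne_zero]
  simp only [Complex.normSq_apply, Complex.sub_re, Complex.sub_im, Complex.one_re,
    Complex.one_im] at *
  linarith

theorem one_add_div_one_sub {z : ℂ} (hz1 : z ≠ 1) : (1 + z) / (1 - z) = 2 * (1 - z)⁻¹ - 1 := by
  have : 1 - z ≠ 0 := sub_ne_zero.mpr hz1.symm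
  field_simp
  ring

/-- On the unit circle the kernel is an oscillating factor times a value of `J_0`. -/
theorem fracKernel₁_eq {z : ℂ} (hz : ‖z‖ = 1) (hz1 : z ≠ 1) {x y : ℝ} (hx : 0 ≤ x) (hy : 0 ≤ y) :
    fracKernel₁ z x y =
      Complex.exp (-(1 / 2) * ((1 + z) / (1 - z)) * ((x : ℂ) + (y : ℂ))) *
        (besselJ0 (2 * Real.sqrt (x * y) / ‖1 - z‖) : ℂ) := by
  rw [fracKernel₁, besselI0_two_mul_cpow_half_div, besselJ0, Complex.ofReal_tsum]
  congr 1
  refine tsum_congr fun k => ?_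
  rw [mul_div_assoc, div_one_sub_sq hz hz1, mul_div_assoc 2, mul_div_cancel_left₀ _ two_ne_zero,
    pow_mul, div_pow, Real.sq_sqrt (mul_nonneg hx hy), ← mul_pow]
  push_cast
  ring_nf

theorem norm_fracKernel₁_le_one {z : ℂ} (hz : ‖z‖ = 1) (hz1 : z ≠ 1) {x y : ℝ} (hx : 0 ≤ x)
    (hy : 0 ≤ y) : ‖fracKernel₁ z x y‖ ≤ 1 := by
  rw [fracKernel₁_eq hz hz1 hx hy, norm_mul, Complex.norm_exp, Complex.norm_real, Real.norm_eq_abs]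
  have h : (-(1 / 2) * ((1 + z) / (1 - z)) * ((x : ℂ) + (y : ℂ))).re = 0 := by
    rw [one_add_div_one_sub hz1,
      show -(1 / 2) * (2 * (1 - z)⁻¹ - 1) * ((x : ℂ) + (y : ℂ)) =
        ((-(x + y) : ℝ) : ℂ) * ((1 - z)⁻¹ - ((1 / 2 : ℝ) : ℂ)) by push_cast; ring,
      Complex.re_ofReal_mul, Complex.sub_re, re_inv_one_sub hz hz1, Complex.ofReal_re, sub_self,
      mul_zero]
  rw [h, Real.exp_zero, one_mul]
  exact abs_besselJ0_le_one _

theorem continuousOn_fracKernel₁ {z : ℂ} (hz : ‖z‖ = 1) (hz1 : z ≠ 1) {x : ℝ} (hx : 0 ≤ x) :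
    ContinuousOn (fracKernel₁ z x) (Set.Ioi 0) := by
  have h : Continuous fun y : ℝ =>
      Complex.exp (-(1 / 2) * ((1 + z) / (1 - z)) * ((x : ℂ) + (y : ℂ))) *
        (besselJ0 (2 * Real.sqrt (x * y) / ‖1 - z‖) : ℂ) := by
    fun_prop
  exact h.continuousOn.congr fun y hy => fracKernel₁_eq hz hz1 hx (le_of_lt hy)

/-! ### The Laguerre functions are eigenfunctions -/

/-- Shift the index by `j`: `C(k+j, j)/(k+j)! = 1/(j! k!)` leaves the exponential series. -/
theorem hasSum_pow_mul_choose_div_factorial (w : ℂ) (j : ℕ) :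
    HasSum (fun k : ℕ => w ^ k * (k.choose j : ℂ) / (k.factorial : ℂ))
      (w ^ j / (j.factorial : ℂ) * Complex.exp w) := by
  rw [← hasSum_nat_add_iff' j, Finset.sum_eq_zero, sub_zero]
  · have h : HasSum (fun k : ℕ => w ^ k / (k.factorial : ℂ)) (Complex.exp w) := by
      rw [Complex.exp_eq_exp_ℂ]
      exact NormedSpace.expSeries_div_hasSum_exp w
    convert! h.mul_left (w ^ j / (j.factorial : ℂ)) using 2 with k
    have h1 : (((k + j).choose j : ℕ) : ℂ) * (j.factorial * k.factorial) = (k + j).factorial := by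
      rw [mul_comm (j.factorial : ℂ), ← mul_assoc]
      exact_mod_cast Nat.add_choose_mul_factorial_mul_factorial k j
    have h2 : (j.factorial : ℂ) ≠ 0 := by exact_mod_cast j.factorial_ne_zero
    have h3 : (k.factorial : ℂ) ≠ 0 := by exact_mod_cast k.factorial_ne_zero
    have h4 : ((k + j).factorial : ℂ) ≠ 0 := by exact_mod_cast (k + j).factorial_ne_zero
    rw [pow_add, div_mul_div_comm, div_eq_div_iff h4 (mul_ne_zero h2 h3), ← h1]
    ring
  · intro k hk
    rw [Nat.choose_eq_zero_of_lt (Finset.mem_range.mp hk)]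
    simp

theorem integral_pow_mul_exp (k : ℕ) {b : ℝ} (hb : 0 < b) :
    ∫ y in Set.Ioi (0 : ℝ), y ^ k * Real.exp (-b * y) = (k.factorial : ℝ) / b ^ (k + 1) := by
  have h := integral_pow_mul_cexp k (p := b) (by simpa using hb)
  have h2 (y : ℝ) : (y : ℂ) ^ k * Complex.exp (-b * y) =
      ((y ^ k * Real.exp (-b * y) : ℝ) : ℂ) := by
    push_cast
    rfl
  simp only [h2, integral_complex_ofReal] at h
  exact_mod_cast h

/-- Gamma integrals at rate `1/2` and `(k+m)! ≤ 2^{k+m} k! m!` give a factor `4^{k+m}`. The growth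
`4^k k!` in `k` is harmless against the `(k!)²` of the Bessel series. -/
theorem integral_norm_pow_mul_laguerrePoly_mul_cexp_le (n k : ℕ) {p : ℂ} (hp : p.re = 1 / 2) :
    ∫ y in Set.Ioi (0 : ℝ), ‖(y : ℂ) ^ k * (laguerrePoly n y : ℂ) * Complex.exp (-p * y)‖ ≤
      (∑ m ∈ Finset.range (n + 1), (n.choose m : ℝ) * 2 * 4 ^ m) * (4 ^ k * k.factorial) := by
  have hp' : 0 < p.re := by rw [hp]; norm_num
  have hint (m : ℕ) : IntegrableOn (fun y : ℝ => (n.choose m : ℝ) / (m.factorial : ℝ) *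
      (y ^ (k + m) * Real.exp (-(1 / 2) * y))) (Set.Ioi 0) :=
    (integrableOn_pow_mul_exp (k + m) (by norm_num)).const_mul _
  calc _ ≤ ∫ y in Set.Ioi (0 : ℝ), ∑ m ∈ Finset.range (n + 1),
        (n.choose m : ℝ) / (m.factorial : ℝ) * (y ^ (k + m) * Real.exp (-(1 / 2) * y)) := by
        refine setIntegral_mono_on (integrableOn_pow_mul_laguerrePoly_mul_cexp k n hp').norm
          (integrable_finsetSum _ fun m _ => hint m) measurableSet_Ioi fun y hy => ?_
        have hy : 0 < y := hy
        rw [pow_mul_laguerrePoly_mul_cexp]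
        refine (norm_sum_le _ _).trans (Finset.sum_le_sum fun m _ => le_of_eq ?_)
        simp [Complex.norm_exp, hp, abs_of_pos hy]
    _ = ∑ m ∈ Finset.range (n + 1), (n.choose m : ℝ) / (m.factorial : ℝ) *
        (((k + m).factorial : ℝ) / (1 / 2) ^ (k + m + 1)) := by
        rw [integral_finsetSum _ fun m _ => hint m]
        refine Finset.sum_congr rfl fun m _ => ?_
        rw [integral_const_mul, integral_pow_mul_exp _ (by norm_num)]
    _ ≤ _ := by
        rw [Finset.sum_mul]
        refine Finset.sum_le_sum fun m _ => ?_
        have h1 : ((k + m).factorial : ℝ) ≤ 2 ^ (k + m) * (k.factorial * m.factorial) := by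
          rw [← mul_assoc]
          exact_mod_cast (Nat.add_choose_mul_factorial_mul_factorial k m).symm.le.trans
            (by gcongr; exact Nat.choose_le_two_pow _ _)
        have h2 : (m.factorial : ℝ) ≠ 0 := by positivity
        calc _ ≤ (n.choose m : ℝ) / (m.factorial : ℝ) *
              ((2 ^ (k + m) * (k.factorial * m.factorial)) / (1 / 2) ^ (k + m + 1)) := by gcongr
          _ = _ := by
            rw [show (4 : ℝ) = 2 * 2 by norm_num, mul_pow, mul_pow, one_div, inv_pow, div_inv_eq_mul,
              pow_succ, pow_add]
            field_simp

/-- Each moment is a finite sum over `j` of multiples of `C(k, j)`, so the sum over `k` is a finite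
combination of exponential series. -/
theorem hasSum_integral_laguerre_pow (n : ℕ) {z : ℂ} (hz : ‖z‖ = 1) (hz1 : z ≠ 1) (x : ℝ) :
    HasSum (fun k : ℕ => ((x : ℂ) * (z / (1 - z) ^ 2)) ^ k / (k.factorial : ℂ) ^ 2 *
        ∫ y in Set.Ioi (0 : ℝ),
          (y : ℂ) ^ k * (laguerrePoly n y : ℂ) * Complex.exp (-(1 - z)⁻¹ * y))
      ((1 - z) * Complex.exp (x * ((1 - z)⁻¹ - 1)) * (z ^ n * (laguerrePoly n x : ℂ))) := by
  set p : ℂ := (1 - z)⁻¹ with hpdef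
  have hzp : 1 - z = p⁻¹ := by rw [hpdef, inv_inv]
  have hp0 : p ≠ 0 := inv_ne_zero (sub_ne_zero.mpr hz1.symm)
  have hz' : z = 1 - 1 / p := by rw [one_div, ← hzp]; ring
  have hp' : 0 < p.re := by rw [hpdef, re_inv_one_sub hz hz1]; norm_num
  have hmain := hasSum_sum (s := Finset.range (n + 1)) (fun j _ =>
    (hasSum_pow_mul_choose_div_factorial (x * (p - 1)) j).mul_left
      (p⁻¹ * ((n.choose j : ℂ) * (-1 / p) ^ j * z ^ (n - j))))
  convert! hmain using 1
  · funext k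
    rw [integral_pow_mul_laguerrePoly_mul_cexp k n hp', sum_choose_mul_add_choose_mul_pow,
      Finset.mul_sum, Finset.mul_sum]
    refine Finset.sum_congr rfl fun j _ => ?_
    have h1 : 1 + -1 / p = z := by rw [hz']; ring
    have h2 : (x : ℂ) * (z / (1 - z) ^ 2) = x * (p - 1) * p := by
      rw [hzp, hz']
      field_simp
    have h3 : (k.factorial : ℂ) ≠ 0 := by exact_mod_cast k.factorial_ne_zero
    rw [h1, h2, mul_pow _ p]
    field_simp
    ring
  · rw [hzp, laguerrePoly_ofReal, Finset.mul_sum, Finset.mul_sum]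
    refine Finset.sum_congr rfl fun j hj => ?_
    have hj : j ≤ n := by have := Finset.mem_range.mp hj; omega
    -- Since `(p-1)/p = z`, the `j`-th term supplies `z^j`, which completes `z^(n-j)` to the
    -- eigenvalue `z^n`.
    have h4 : (x : ℂ) * (p - 1) * (1 / p) = x * z := by
      rw [hz']
      field_simp
    have h5 : (-1 / p) ^ j * (x * (p - 1)) ^ j = (-1) ^ j * (x : ℂ) ^ j * z ^ j := by
      rw [← mul_pow, ← mul_pow, ← mul_pow]
      congr 1
      linear_combination -h4
    have h6 : z ^ n = z ^ j * z ^ (n - j) := by rw [← pow_add]; congr 1; omega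
    rw [h6]
    linear_combination -(p⁻¹ * (n.choose j : ℂ) * z ^ (n - j) / (j.factorial : ℂ) *
      Complex.exp (x * (p - 1))) * h5

/-- The factor `e^{-y/2}` of the Laguerre function merges with the kernel's `e^{-(p-1/2)y}` into
`e^{-py}`. -/
theorem laguerreFun₁_mul_fracKernel₁ (n : ℕ) {z : ℂ} (hz1 : z ≠ 1) (x y : ℝ) :
    (laguerreFun₁ n y : ℂ) * fracKernel₁ z x y =
      Complex.exp (-x * ((1 - z)⁻¹ - 1 / 2)) *
      ∑' k : ℕ, ((x : ℂ) * (z / (1 - z) ^ 2)) ^ k / (k.factorial : ℂ) ^ 2 *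
          ((y : ℂ) ^ k * (laguerrePoly n y : ℂ) * Complex.exp (-(1 - z)⁻¹ * y)) := by
  rw [fracKernel₁, besselI0_two_mul_cpow_half_div, one_add_div_one_sub hz1, laguerreFun₁]
  have h : Complex.exp (-(1 / 2) * (2 * (1 - z)⁻¹ - 1) * ((x : ℂ) + (y : ℂ))) *
      Complex.exp (-y / 2) =
      Complex.exp (-x * ((1 - z)⁻¹ - 1 / 2)) * Complex.exp (-(1 - z)⁻¹ * y) := by
    rw [← Complex.exp_add, ← Complex.exp_add]
    ring_nf
  push_cast
  rw [← tsum_mul_left, ← tsum_mul_left, ← tsum_mul_left]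
  refine tsum_congr fun k => ?_
  have h2 : (x : ℂ) * y * z / (1 - z) ^ 2 = (x * (z / (1 - z) ^ 2)) * y := by ring
  rw [h2, mul_pow _ (y : ℂ)]
  linear_combination (laguerrePoly n y : ℂ) * ((x * (z / (1 - z) ^ 2)) ^ k * (y : ℂ) ^ k /
    (k.factorial : ℂ) ^ 2) * h

theorem integral_laguerreFun₁_mul_fracKernel₁ (n : ℕ) {z : ℂ} (hz : ‖z‖ = 1) (hz1 : z ≠ 1)
    (x : ℝ) :
    ∫ y in Set.Ioi (0 : ℝ), (laguerreFun₁ n y : ℂ) * fracKernel₁ z x y =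
      (1 - z) * (z ^ n * (laguerreFun₁ n x : ℂ)) := by
  have hp := re_inv_one_sub hz hz1
  have hp' : 0 < ((1 - z)⁻¹).re := by rw [hp]; norm_num
  simp only [laguerreFun₁_mul_fracKernel₁ n hz1]
  rw [integral_const_mul]
  have hsum := hasSum_integral_of_summable_integral_norm (μ := volume.restrict (Set.Ioi (0 : ℝ)))
    (F := fun (k : ℕ) (y : ℝ) => ((x : ℂ) * (z / (1 - z) ^ 2)) ^ k / (k.factorial : ℂ) ^ 2 *
          ((y : ℂ) ^ k * (laguerrePoly n y : ℂ) * Complex.exp (-(1 - z)⁻¹ * y)))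
    (fun k => (integrableOn_pow_mul_laguerrePoly_mul_cexp k n hp').const_mul _) ?_
  · simp only [integral_const_mul] at hsum
    rw [hsum.unique (hasSum_integral_laguerre_pow n hz hz1 x), laguerreFun₁]
    have h : Complex.exp (-x * ((1 - z)⁻¹ - 1 / 2)) * Complex.exp (x * ((1 - z)⁻¹ - 1)) =
        Complex.exp (-x / 2) := by
      rw [← Complex.exp_add]
      ring_nf
    push_cast
    linear_combination (1 - z) * z ^ n * (laguerrePoly n x : ℂ) * h
  -- The integrals of the norms are dominated by a multiple of the series of `exp(4‖c‖)`.
  · set c := (x : ℂ) * (z / (1 - z) ^ 2)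
    simp only [norm_mul _ (_ * _)]
    refine Summable.of_nonneg_of_le (fun k => by positivity) (fun k => ?_)
      ((Real.summable_pow_div_factorial (4 * ‖c‖)).mul_left
        (∑ m ∈ Finset.range (n + 1), (n.choose m : ℝ) * 2 * 4 ^ m))
    rw [integral_const_mul]
    refine (mul_le_mul_of_nonneg_left (integral_norm_pow_mul_laguerrePoly_mul_cexp_le n k hp)
      (norm_nonneg _)).trans (le_of_eq ?_)
    have h3 : (k.factorial : ℝ) ≠ 0 := by positivity
    rw [norm_div, norm_pow, norm_pow, Complex.norm_natCast, mul_pow]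
    generalize ∑ m ∈ Finset.range (n + 1), (n.choose m : ℝ) * 2 * 4 ^ m = D
    field_simp

/-! ### Products over the coordinates -/

variable {d : ℕ}

theorem lebesgue_eq_pi (d : ℕ) : lebesgue d = Measure.pi fun _ => halfLine := rfl

theorem laguerreFun_eq_prod (n : Fin d → ℕ) (x : Orthant d) :
    laguerreFun n x = ∏ j, laguerreFun₁ (n j) (x j) := rfl

theorem fracKernel_eq_prod (z : ℂ) (x y : Orthant d) :
    fracKernel z x y = ∏ j, fracKernel₁ z (x j) (y j) := rfl

theorem integrable_lebesgue_prod {E : Type*} [RCLike E] {f : Fin d → ℝ → E}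
    (hf : ∀ j, IntegrableOn (f j) (Set.Ioi 0)) :
    Integrable (fun x : Orthant d => ∏ j, f j (x j)) (lebesgue d) :=
  Integrable.fintype_prod (f := fun j (y : Set.Ioi (0 : ℝ)) => f j y)
    fun j => integrable_halfLine_iff.mpr (hf j)

theorem integral_lebesgue_prod {E : Type*} [RCLike E] (f : Fin d → ℝ → E) :
    ∫ x : Orthant d, ∏ j, f j (x j) ∂(lebesgue d) = ∏ j, ∫ y in Set.Ioi (0 : ℝ), f j y := by
  rw [lebesgue_eq_pi, integral_fintype_prod_eq_prod (fun j (y : Set.Ioi (0 : ℝ)) => f j y)]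
  exact Finset.prod_congr rfl fun j _ => integral_subtype_comap measurableSet_Ioi (f j)

theorem laguerreFun_mul_ofReal (n m : Fin d → ℕ) (x : Orthant d) :
    (laguerreFun n x : ℂ) * (laguerreFun m x : ℂ) =
      ∏ j, ((laguerreFun₁ (n j) (x j) : ℂ) * (laguerreFun₁ (m j) (x j) : ℂ)) := by
  rw [laguerreFun_eq_prod, laguerreFun_eq_prod, Finset.prod_mul_distrib]
  push_cast
  rfl

theorem integrable_laguerreFun_mul (n m : Fin d → ℕ) :
    Integrable (fun x => (laguerreFun n x : ℂ) * (laguerreFun m x : ℂ)) (lebesgue d) := by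
  simp only [laguerreFun_mul_ofReal]
  exact integrable_lebesgue_prod
    (f := fun j y => (laguerreFun₁ (n j) y : ℂ) * (laguerreFun₁ (m j) y : ℂ))
    fun j => integrableOn_laguerreFun₁_mul_ofReal _ _

theorem integral_laguerreFun_mul (n m : Fin d → ℕ) :
    ∫ x, (laguerreFun n x : ℂ) * (laguerreFun m x : ℂ) ∂(lebesgue d) = if n = m then 1 else 0 := by
  simp only [laguerreFun_mul_ofReal]
  rw [integral_lebesgue_prod
    (fun j y => (laguerreFun₁ (n j) y : ℂ) * (laguerreFun₁ (m j) y : ℂ))]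
  simp only [integral_laguerreFun₁_mul_ofReal]
  rw [Finset.prod_ite_zero]
  simp [funext_iff]

theorem integrable_abs_laguerreFun (n : Fin d → ℕ) :
    Integrable (fun x => |laguerreFun n x|) (lebesgue d) :=
  (integrable_lebesgue_prod (f := fun j y => laguerreFun₁ (n j) y)
    fun _ => integrableOn_laguerreFun₁ _).abs

theorem integral_abs_laguerreFun_le (n : Fin d → ℕ) :
    ∫ x, |laguerreFun n x| ∂(lebesgue d) ≤ 73 ^ d * ∏ j, ((n j : ℝ) + 1) ^ 2 := by
  simp only [laguerreFun_eq_prod, Finset.abs_prod]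
  rw [integral_lebesgue_prod (fun j y => |laguerreFun₁ (n j) y|)]
  refine (Finset.prod_le_prod (fun j _ => integral_nonneg fun _ => abs_nonneg _)
    fun j _ => integral_abs_laguerreFun₁_le (n j)).trans (le_of_eq ?_)
  rw [Finset.prod_mul_distrib]
  simp

/-- `|ab| ≤ (a² + b²)/2` and the normalisation in `L²`. -/
theorem integral_abs_laguerreFun_mul_le (n m : Fin d → ℕ) :
    ∫ x, ‖(laguerreFun n x : ℂ) * (laguerreFun m x : ℂ)‖ ∂(lebesgue d) ≤ 1 := by
  have hsq (k : Fin d → ℕ) : Integrable (fun x => laguerreFun k x ^ 2) (lebesgue d) := by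
    refine (integrable_laguerreFun_mul k k).re.congr (Filter.Eventually.of_forall fun x => ?_)
    simp [← Complex.ofReal_mul, pow_two]
  have hsq' (k : Fin d → ℕ) : ∫ x, laguerreFun k x ^ 2 ∂(lebesgue d) = 1 := by
    have h := integral_laguerreFun_mul k k
    simp only [← pow_two, if_true] at h
    exact_mod_cast h
  calc _ ≤ ∫ x, (1 / 2 * laguerreFun n x ^ 2 + 1 / 2 * laguerreFun m x ^ 2) ∂(lebesgue d) := by
        refine integral_mono (integrable_laguerreFun_mul n m).norm
          (((hsq n).const_mul _).add ((hsq m).const_mul _)) fun x => ?_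
        simp only [norm_mul, Complex.norm_real, Real.norm_eq_abs]
        nlinarith [sq_nonneg (|laguerreFun n x| - |laguerreFun m x|), sq_abs (laguerreFun n x),
          sq_abs (laguerreFun m x)]
    _ = 1 := by
        rw [integral_add ((hsq n).const_mul _) ((hsq m).const_mul _), integral_const_mul,
          integral_const_mul, hsq', hsq']
        norm_num

theorem norm_fracKernel_le_one {z : ℂ} (hz : ‖z‖ = 1) (hz1 : z ≠ 1) (x y : Orthant d) :
    ‖fracKernel z x y‖ ≤ 1 := by
  rw [fracKernel_eq_prod, norm_prod]
  exact Finset.prod_le_one (fun j _ => norm_nonneg _)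
    fun j _ => norm_fracKernel₁_le_one hz hz1 (x j).2.le (y j).2.le

theorem integrableOn_laguerreFun₁_mul_fracKernel₁ (n : ℕ) {z : ℂ} (hz : ‖z‖ = 1) (hz1 : z ≠ 1)
    {x : ℝ} (hx : 0 ≤ x) :
    IntegrableOn (fun y => (laguerreFun₁ n y : ℂ) * fracKernel₁ z x y) (Set.Ioi 0) := by
  refine (integrableOn_laguerreFun₁ n).abs.mono' (ContinuousOn.aestronglyMeasurable
    ((Complex.continuous_ofReal.comp (continuous_laguerreFun₁ n)).continuousOn.mul
      (continuousOn_fracKernel₁ hz hz1 hx)) measurableSet_Ioi) ?_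
  filter_upwards [ae_restrict_mem measurableSet_Ioi] with y hy
  rw [norm_mul, Complex.norm_real, Real.norm_eq_abs]
  exact mul_le_of_le_one_right (abs_nonneg _) (norm_fracKernel₁_le_one hz hz1 hx (le_of_lt hy))

theorem laguerreFun_mul_fracKernel (n : Fin d → ℕ) (z : ℂ) (x y : Orthant d) :
    (laguerreFun n y : ℂ) * fracKernel z x y =
      ∏ j, ((laguerreFun₁ (n j) (y j) : ℂ) * fracKernel₁ z (x j) (y j)) := by
  rw [laguerreFun_eq_prod, fracKernel_eq_prod, Finset.prod_mul_distrib]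
  push_cast
  rfl

theorem integrable_laguerreFun_mul_fracKernel (n : Fin d → ℕ) {z : ℂ} (hz : ‖z‖ = 1)
    (hz1 : z ≠ 1) (x : Orthant d) :
    Integrable (fun y => (laguerreFun n y : ℂ) * fracKernel z x y) (lebesgue d) := by
  simp only [laguerreFun_mul_fracKernel]
  exact integrable_lebesgue_prod
    (f := fun j y => (laguerreFun₁ (n j) y : ℂ) * fracKernel₁ z (x j) y)
    fun j => integrableOn_laguerreFun₁_mul_fracKernel₁ _ hz hz1 (x j).2.le

theorem integral_laguerreFun_mul_fracKernel (n : Fin d → ℕ) {z : ℂ} (hz : ‖z‖ = 1)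
    (hz1 : z ≠ 1) (x : Orthant d) :
    ∫ y, (laguerreFun n y : ℂ) * fracKernel z x y ∂(lebesgue d) =
      (1 - z) ^ d * (z ^ (∑ j, n j) * (laguerreFun n x : ℂ)) := by
  simp only [laguerreFun_mul_fracKernel]
  rw [integral_lebesgue_prod
    (fun j y => (laguerreFun₁ (n j) y : ℂ) * fracKernel₁ z (x j) y)]
  simp only [integral_laguerreFun₁_mul_fracKernel₁ _ hz hz1]
  rw [Finset.prod_mul_distrib, Finset.prod_mul_distrib, Finset.prod_pow_eq_pow_sum,
    laguerreFun_eq_prod]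
  simp

theorem integral_norm_laguerreFun_mul_fracKernel_le (n : Fin d → ℕ) {z : ℂ} (hz : ‖z‖ = 1)
    (hz1 : z ≠ 1) (x : Orthant d) :
    ∫ y, ‖(laguerreFun n y : ℂ) * fracKernel z x y‖ ∂(lebesgue d) ≤
      73 ^ d * ∏ j, ((n j : ℝ) + 1) ^ 2 := by
  refine le_trans (integral_mono (integrable_laguerreFun_mul_fracKernel n hz hz1 x).norm
    (integrable_abs_laguerreFun n) fun y => ?_) (integral_abs_laguerreFun_le n)
  simp only [norm_mul, Complex.norm_real, Real.norm_eq_abs]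
  exact mul_le_of_le_one_right (abs_nonneg _) (norm_fracKernel_le_one hz hz1 x y)

/-! ### Summability over multi-indices -/

/-- A finite set of multi-indices lies in a box, over which the sum of products is a product of
sums. -/
theorem summable_prod_of_summable {f : ℕ → ℝ} (hf : Summable f) (h0 : ∀ k, 0 ≤ f k) :
    Summable fun n : Fin d → ℕ => ∏ j, f (n j) := by
  refine summable_of_sum_le (c := ∏ _j : Fin d, ∑' k, f k)
    (fun n => Finset.prod_nonneg fun j _ => h0 _) fun s => ?_
  calc ∑ n ∈ s, ∏ j, f (n j)
      ≤ ∑ n ∈ Fintype.piFinset fun j => s.image fun n => n j, ∏ j, f (n j) := by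
        refine Finset.sum_le_sum_of_subset_of_nonneg (fun n hn => ?_)
          fun n _ _ => Finset.prod_nonneg fun j _ => h0 _
        exact Fintype.mem_piFinset.mpr fun j => Finset.mem_image_of_mem _ hn
    _ = ∏ j, ∑ k ∈ s.image fun n => n j, f k := (Finset.prod_univ_sum _ _).symm
    _ ≤ _ := Finset.prod_le_prod (fun j _ => Finset.sum_nonneg fun k _ => h0 k)
        fun j _ => hf.sum_le_tsum _ fun k _ => h0 k

/-- Keep one term of the exponential series, of order `N ≥ K/γ`. -/
theorem exists_one_add_pow_le_exp_rpow (K : ℕ) {r γ : ℝ} (hr : 0 < r) (hγ : 0 < γ) :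
    ∃ C : ℝ, 0 < C ∧ ∀ t : ℕ, (1 + (t : ℝ)) ^ K ≤ C * Real.exp (r * (t : ℝ) ^ γ) := by
  obtain ⟨N, hN⟩ := exists_nat_ge (K / γ)
  have hN' : (K : ℝ) ≤ γ * N := by rwa [div_le_iff₀' hγ] at hN
  -- The summand `1` covers `t = 0`; the comparison of powers needs `t ≥ 1`.
  refine ⟨1 + 2 ^ K * N.factorial / r ^ N, by positivity, fun t => ?_⟩
  have he : 1 ≤ Real.exp (r * (t : ℝ) ^ γ) := Real.one_le_exp (by positivity)
  rcases Nat.eq_zero_or_pos t with rfl | ht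
  · have : (1 + ((0 : ℕ) : ℝ)) ^ K = 1 := by simp
    rw [this]
    refine one_le_mul_of_one_le_of_one_le ?_ he
    exact le_add_of_nonneg_right (by positivity)
  have ht' : (1 : ℝ) ≤ t := by exact_mod_cast ht
  have h1 : (r * (t : ℝ) ^ γ) ^ N / N.factorial ≤ Real.exp (r * (t : ℝ) ^ γ) :=
    Real.pow_div_factorial_le_exp _ (by positivity) N
  have h2 : (t : ℝ) ^ K ≤ ((t : ℝ) ^ γ) ^ N := by
    rw [← Real.rpow_natCast, ← Real.rpow_natCast, ← Real.rpow_mul (by positivity)]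
    exact Real.rpow_le_rpow_of_exponent_le ht' hN'
  calc (1 + (t : ℝ)) ^ K ≤ (2 * t) ^ K := by gcongr; linarith
    _ ≤ 2 ^ K * ((t : ℝ) ^ γ) ^ N := by rw [mul_pow]; gcongr
    _ = 2 ^ K * N.factorial / r ^ N * ((r * (t : ℝ) ^ γ) ^ N / N.factorial) := by
        rw [mul_pow]
        have : (N.factorial : ℝ) ≠ 0 := by positivity
        field_simp
    _ ≤ 2 ^ K * N.factorial / r ^ N * Real.exp (r * (t : ℝ) ^ γ) := by gcongr
    _ ≤ _ := by gcongr; linarith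

theorem summable_norm_mul_prod_of_mem_roumieuSub {β : ℝ} (hβ : 0 < β) {a : (Fin d → ℕ) → ℂ}
    (ha : a ∈ roumieuSub d β) : Summable fun n => ‖a n‖ * ∏ j, ((n j : ℝ) + 1) ^ 2 := by
  obtain ⟨r, hr, ha⟩ := ha
  obtain ⟨A, hA⟩ := memℓp_infty_iff.mp ha
  -- Per coordinate, the power `4` pays for the growth `(n_j+1)²` and leaves a summable `(n_j+1)⁻²`.
  obtain ⟨C, hC, hCt⟩ := exists_one_add_pow_le_exp_rpow (4 * d) hr
    (show 0 < 1 / (2 * β) by positivity)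
  have hs : Summable fun k : ℕ => (((k : ℝ) + 1) ^ 2)⁻¹ := by
    have := (summable_nat_add_iff 1).mpr (Real.summable_nat_pow_inv.mpr (show 1 < 2 by norm_num))
    exact_mod_cast this
  refine Summable.of_nonneg_of_le (fun n => by positivity) (fun n => ?_)
    ((summable_prod_of_summable hs fun k => by positivity).mul_left (A * C))
  have hA' : weight d r β n * ‖a n‖ ≤ A := by
    have := hA ⟨n, rfl⟩
    simpa only [norm_mul, Complex.norm_real, Real.norm_eq_abs,
      abs_of_pos (show 0 < weight d r β n from Real.exp_pos _)] using this
  have h4 : ∏ j, ((n j : ℝ) + 1) ^ 4 ≤ C * weight d r β n := by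
    refine le_trans ?_ (hCt (∑ j, n j))
    calc ∏ j, ((n j : ℝ) + 1) ^ 4 ≤ ∏ _j : Fin d, (1 + ((∑ j, n j : ℕ) : ℝ)) ^ 4 := by
          refine Finset.prod_le_prod (fun j _ => by positivity) fun j _ => ?_
          have : (n j : ℝ) ≤ ((∑ j, n j : ℕ) : ℝ) := by
            exact_mod_cast Finset.single_le_sum (fun i _ => Nat.zero_le (n i)) (Finset.mem_univ j)
          rw [add_comm]
          gcongr
      _ = _ := by simp [pow_mul]
  have h5 : ∏ j, ((n j : ℝ) + 1) ^ 2 =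
      (∏ j, ((n j : ℝ) + 1) ^ 4) * ∏ j, (((n j : ℝ) + 1) ^ 2)⁻¹ := by
    rw [← Finset.prod_mul_distrib]
    refine Finset.prod_congr rfl fun j _ => ?_
    have : ((n j : ℝ) + 1) ≠ 0 := by positivity
    field_simp
  rw [h5, ← mul_assoc]
  refine mul_le_mul_of_nonneg_right ?_ (by positivity)
  calc ‖a n‖ * ∏ j, ((n j : ℝ) + 1) ^ 4 ≤ ‖a n‖ * (C * weight d r β n) := by gcongr
    _ = (weight d r β n * ‖a n‖) * C := by ring
    _ ≤ A * C := by gcongr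

/-! ### Termwise integration of a Laguerre series -/

theorem integrable_of_hasSum_of_summable_integral_norm {X ι : Type*} [MeasurableSpace X]
    {μ : Measure X} [Countable ι] {F : ι → X → ℂ} {f : X → ℂ} (hF : ∀ i, Integrable (F i) μ)
    (hsum : Summable fun i => ∫ x, ‖F i x‖ ∂μ) (hf : ∀ x, HasSum (fun i => F i x) (f x)) :
    Integrable f μ := by
  refine ⟨aestronglyMeasurable_of_tendsto_ae Filter.atTop
    (f := fun s x => ∑ i ∈ s, F i x) (fun s => ?_) (Filter.Eventually.of_forall hf), ?_⟩
  · exact Finset.aestronglyMeasurable_fun_sum _ fun i _ => (hF i).1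
  · have hle (x : X) : ‖f x‖ₑ ≤ ∑' i, ‖F i x‖ₑ := by
      have hn : Summable fun i => ‖F i x‖ := (hf x).summable.norm
      rw [← (hf x).tsum_eq]
      simp only [← ofReal_norm]
      rw [← ENNReal.ofReal_tsum_of_nonneg (fun i => norm_nonneg _) hn]
      exact ENNReal.ofReal_le_ofReal (norm_tsum_le_tsum_norm hn)
    refine lt_of_le_of_lt (lintegral_mono hle) ?_
    rw [lintegral_tsum fun i => (hF i).1.enorm]
    simp only [fun i => ofReal_integral_norm_eq_lintegral_enorm (hF i) |>.symm]
    exact hsum.tsum_ofReal_ne_top.lt_top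

/-- Used with `h` the kernel, to compute the transform, and with `h` a Laguerre function, to recover
coefficients. -/
theorem integrable_and_hasSum_integral_laguerreSeries {a : (Fin d → ℕ) → ℂ} {f : Orthant d → ℂ}
    (hf : ∀ x, HasSum (fun n => a n * (laguerreFun n x : ℂ)) (f x)) {h : Orthant d → ℂ}
    (hint : ∀ n, Integrable (fun x => (laguerreFun n x : ℂ) * h x) (lebesgue d))
    (hsum : Summable fun n => ‖a n‖ * ∫ x, ‖(laguerreFun n x : ℂ) * h x‖ ∂(lebesgue d)) :
    Integrable (fun x => f x * h x) (lebesgue d) ∧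
      HasSum (fun n => a n * ∫ x, (laguerreFun n x : ℂ) * h x ∂(lebesgue d))
        (∫ x, f x * h x ∂(lebesgue d)) := by
  have hF (n : Fin d → ℕ) :
      Integrable (fun x => a n * ((laguerreFun n x : ℂ) * h x)) (lebesgue d) :=
    (hint n).const_mul _
  have hs : Summable fun n => ∫ x, ‖a n * ((laguerreFun n x : ℂ) * h x)‖ ∂(lebesgue d) := by
    simpa only [norm_mul (a _), integral_const_mul] using hsum
  have hfx (x : Orthant d) :
      HasSum (fun n => a n * ((laguerreFun n x : ℂ) * h x)) (f x * h x) := by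
    simpa only [mul_assoc] using (hf x).mul_right (h x)
  refine ⟨integrable_of_hasSum_of_summable_integral_norm hF hs hfx, ?_⟩
  have := hasSum_integral_of_summable_integral_norm hF hs
  simpa only [integral_const_mul, fun x => (hfx x).tsum_eq] using this

theorem integrable_mul_fracKernel_and_hasSum {β : ℝ} (hβ : 0 < β) {a : (Fin d → ℕ) → ℂ}
    (ha : a ∈ roumieuSub d β) {f : Orthant d → ℂ}
    (hf : ∀ x, HasSum (fun n => a n * (laguerreFun n x : ℂ)) (f x)) {z : ℂ} (hz : ‖z‖ = 1)
    (hz1 : z ≠ 1) (x : Orthant d) :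
    Integrable (fun y => f y * fracKernel z x y) (lebesgue d) ∧
      HasSum (fun n => (z ^ (∑ j, n j) * a n) * (laguerreFun n x : ℂ))
        (fracHankelClifford z f x) := by
  have hs : Summable fun n => ‖a n‖ *
      ∫ y, ‖(laguerreFun n y : ℂ) * fracKernel z x y‖ ∂(lebesgue d) := by
    refine Summable.of_nonneg_of_le
      (fun n => mul_nonneg (norm_nonneg _) (integral_nonneg fun _ => norm_nonneg _)) (fun n => ?_)
      ((summable_norm_mul_prod_of_mem_roumieuSub hβ ha).mul_left (73 ^ d))
    rw [mul_left_comm]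
    exact mul_le_mul_of_nonneg_left (integral_norm_laguerreFun_mul_fracKernel_le n hz hz1 x)
      (norm_nonneg _)
  obtain ⟨h1, h2⟩ := integrable_and_hasSum_integral_laguerreSeries hf
    (fun n => integrable_laguerreFun_mul_fracKernel n hz hz1 x) hs
  refine ⟨h1, ?_⟩
  convert! h2.mul_left ((1 - z) ^ d)⁻¹ using 2 with n
  rw [integral_laguerreFun_mul_fracKernel n hz hz1]
  have : (1 - z) ^ d ≠ 0 := pow_ne_zero _ (sub_ne_zero.mpr hz1.symm)
  field_simp

/-- Orthonormality makes the coefficients unique. Applied to the transformed series, it shows that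
the image lies in the same space. -/
theorem integrable_and_laguerreCoeff_of_hasSum {β : ℝ} (hβ : 0 < β) {a : (Fin d → ℕ) → ℂ}
    (ha : a ∈ roumieuSub d β) {f : Orthant d → ℂ}
    (hf : ∀ x, HasSum (fun n => a n * (laguerreFun n x : ℂ)) (f x)) (m : Fin d → ℕ) :
    Integrable (fun x => f x * (laguerreFun m x : ℂ)) (lebesgue d) ∧ laguerreCoeff f m = a m := by
  have hs : Summable fun n => ‖a n‖ *
      ∫ y, ‖(laguerreFun n y : ℂ) * (laguerreFun m y : ℂ)‖ ∂(lebesgue d) := by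
    refine Summable.of_nonneg_of_le
      (fun n => mul_nonneg (norm_nonneg _) (integral_nonneg fun _ => norm_nonneg _)) (fun n => ?_)
      (summable_norm_mul_prod_of_mem_roumieuSub hβ ha)
    refine mul_le_mul_of_nonneg_left ((integral_abs_laguerreFun_mul_le n m).trans ?_)
      (norm_nonneg _)
    exact Finset.prod_const_one.symm.le.trans
      (Finset.prod_le_prod (fun _ _ => zero_le_one) fun j _ => one_le_pow₀ (by simp))
  obtain ⟨h1, h2⟩ := integrable_and_hasSum_integral_laguerreSeries hf
    (fun n => integrable_laguerreFun_mul n m) hs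
  refine ⟨h1, h2.unique ?_⟩
  simp only [integral_laguerreFun_mul]
  convert! hasSum_ite_eq m (a m) using 2 with n
  split_ifs with h
  · rw [h, mul_one]
  · rw [mul_zero]

/-! ### Multiplication of sequences by `z^{|n|}` -/

/-- Multiplication of a sequence by `z^{|n|}`. -/
def mulPow (z : ℂ) : ((Fin d → ℕ) → ℂ) →ₗ[ℂ] ((Fin d → ℕ) → ℂ) where
  toFun a n := z ^ (∑ j, n j) * a n
  map_add' a b := by
    funext n
    exact mul_add _ _ _
  map_smul' c a := by
    funext n
    exact mul_left_comm _ _ _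

theorem mulPow_apply (z : ℂ) (a : (Fin d → ℕ) → ℂ) (n : Fin d → ℕ) :
    mulPow z a n = z ^ (∑ j, n j) * a n := rfl

theorem norm_mulPow_apply {z : ℂ} (hz : ‖z‖ = 1) (a : (Fin d → ℕ) → ℂ) (n : Fin d → ℕ) :
    ‖mulPow z a n‖ = ‖a n‖ := by
  rw [mulPow_apply, norm_mul, norm_pow, hz, one_pow, one_mul]

theorem mulPow_mulPow_inv {z : ℂ} (hz : ‖z‖ = 1) (a : (Fin d → ℕ) → ℂ) :
    mulPow z (mulPow z⁻¹ a) = a := by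
  have h0 : z ≠ 0 := by
    rintro rfl
    simp at hz
  funext n
  rw [mulPow_apply, mulPow_apply, ← mul_assoc, ← mul_pow, mul_inv_cancel₀ h0, one_pow, one_mul]

theorem mulPow_mem_weightedSub {z : ℂ} (hz : ‖z‖ = 1) {r β : ℝ} {a : (Fin d → ℕ) → ℂ}
    (ha : a ∈ weightedSub d r β) : mulPow z a ∈ weightedSub d r β := by
  obtain ⟨C, hC⟩ := memℓp_infty_iff.mp ha
  refine memℓp_infty_iff.mpr ⟨C, ?_⟩
  rintro _ ⟨n, rfl⟩
  refine le_trans (le_of_eq ?_) (hC ⟨n, rfl⟩)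
  simp only [norm_mul, norm_mulPow_apply hz]

theorem mulPow_mem_roumieuSub {z : ℂ} (hz : ‖z‖ = 1) {β : ℝ} {a : (Fin d → ℕ) → ℂ}
    (ha : a ∈ roumieuSub d β) : mulPow z a ∈ roumieuSub d β := by
  obtain ⟨r, hr, ha⟩ := ha
  exact ⟨r, hr, mulPow_mem_weightedSub hz ha⟩

theorem mulPow_mem_beurlingSub {z : ℂ} (hz : ‖z‖ = 1) {β : ℝ} {a : (Fin d → ℕ) → ℂ}
    (ha : a ∈ beurlingSub d β) : mulPow z a ∈ beurlingSub d β :=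
  fun r hr => mulPow_mem_weightedSub hz (ha r hr)

theorem beurlingSub_le_roumieuSub (d : ℕ) (β : ℝ) : beurlingSub d β ≤ roumieuSub d β :=
  fun _ ha => ⟨1, one_pos, ha 1 one_pos⟩

/-- Multiplication by `z^{|n|}` on `ℓ^∞_{[ϑ_{r,β}]}`. -/
def mulPowWeighted {z : ℂ} (hz : ‖z‖ = 1) (r β : ℝ) :
    WeightedEll d r β →ₗ[ℂ] WeightedEll d r β :=
  (mulPow z).restrict fun _ ha => mulPow_mem_weightedSub hz ha

theorem continuous_mulPowWeighted {z : ℂ} (hz : ‖z‖ = 1) (r β : ℝ) :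
    Continuous (mulPowWeighted (d := d) hz r β) := by
  refine AddMonoidHomClass.continuous_of_bound (mulPowWeighted (d := d) hz r β) 1 fun a => ?_
  rw [one_mul]
  change ‖mulWeight d r β (mulPowWeighted hz r β a)‖ ≤ ‖mulWeight d r β a‖
  refine lp.norm_le_of_forall_le (norm_nonneg _) fun n => le_trans (le_of_eq ?_)
    (lp.norm_apply_le_norm ENNReal.top_ne_zero (mulWeight d r β a) n)
  change ‖(weight d r β n : ℂ) * mulPow z a.1 n‖ = ‖(weight d r β n : ℂ) * a.1 n‖
  rw [norm_mul, norm_mul, norm_mulPow_apply hz]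

/-- Multiplication by `z^{|n|}` on `ℓ_{0,β}`. -/
def mulPowBeurling {z : ℂ} (hz : ‖z‖ = 1) (β : ℝ) : BeurlingEll d β →ₗ[ℂ] BeurlingEll d β :=
  (mulPow z).restrict fun _ ha => mulPow_mem_beurlingSub hz ha

/-- A map into a projective limit is continuous once its composite with each inclusion is, and each
composite factors through a single step. -/
theorem continuous_mulPowBeurling {z : ℂ} (hz : ‖z‖ = 1) (β : ℝ) :
    Continuous (mulPowBeurling (d := d) hz β) := by
  refine continuous_iInf_rng.mpr fun r => continuous_iInf_rng.mpr fun hr =>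
    continuous_induced_rng.mpr ?_
  have h : Continuous (ofBeurling d β hr) :=
    continuous_iInf_dom (continuous_iInf_dom (i := hr) continuous_induced_dom)
  exact (continuous_mulPowWeighted hz r β).comp h

/-- Multiplication by `z^{|n|}` on `ℓ_β`. -/
def mulPowRoumieu {z : ℂ} (hz : ‖z‖ = 1) (β : ℝ) : RoumieuEll d β →ₗ[ℂ] RoumieuEll d β :=
  (mulPow z).restrict fun _ ha => mulPow_mem_roumieuSub hz ha

theorem continuous_mulPowRoumieu {z : ℂ} (hz : ‖z‖ = 1) (β : ℝ) :
    Continuous (mulPowRoumieu (d := d) hz β) := by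
  refine continuous_sInf_rng.mpr fun t ht => ?_
  obtain ⟨h1, h2, h3, h4⟩ := ht
  -- The pullback of an admissible topology is again admissible, because the multiplication maps
  -- each step continuously to itself; the inductive limit topology is therefore finer than it.
  refine continuous_sInf_dom (t := t.induced (mulPowRoumieu (d := d) hz β))
    ⟨topologicalAddGroup_induced _, continuousSMul_induced _,
      LocallyConvexSpace.induced ((mulPowRoumieu (d := d) hz β).restrictScalars ℝ),
      fun r hr => ?_⟩ continuous_induced_dom
  exact continuous_induced_rng.mpr ((h4 r hr).comp (continuous_mulPowWeighted hz r β))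

/-! ### The fractional transform on spaces of Laguerre series -/

/-- The function is the pointwise sum of its Laguerre series, so identities between operators can be
checked on coefficients. -/
theorem laguerreSeries_ext {S : Submodule ℂ ((Fin d → ℕ) → ℂ)} {f g : laguerreSeries d S}
    (h : laguerreCoeff f.1 = laguerreCoeff g.1) : f = g := by
  apply Subtype.ext
  funext x
  have hf := f.2.2.2 x
  rw [h] at hf
  exact hf.unique (g.2.2.2 x)

theorem integrable_mul_fracKernel {β : ℝ} (hβ : 0 < β) {S : Submodule ℂ ((Fin d → ℕ) → ℂ)}
    (hS : S ≤ roumieuSub d β) {z : ℂ} (hz : ‖z‖ = 1) (hz1 : z ≠ 1) (f : laguerreSeries d S)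
    (x : Orthant d) : Integrable (fun y => f.1 y * fracKernel z x y) (lebesgue d) :=
  (integrable_mul_fracKernel_and_hasSum hβ (hS f.2.2.1) f.2.2.2 hz hz1 x).1

theorem hasSum_fracHankelClifford {β : ℝ} (hβ : 0 < β) {S : Submodule ℂ ((Fin d → ℕ) → ℂ)}
    (hS : S ≤ roumieuSub d β) {z : ℂ} (hz : ‖z‖ = 1) (hz1 : z ≠ 1) (f : laguerreSeries d S)
    (x : Orthant d) :
    HasSum (fun n => mulPow z (laguerreCoeff f.1) n * (laguerreFun n x : ℂ))
      (fracHankelClifford z f.1 x) :=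
  (integrable_mul_fracKernel_and_hasSum hβ (hS f.2.2.1) f.2.2.2 hz hz1 x).2

/-- On Laguerre coefficients the fractional transform is multiplication by `z^{|n|}`. -/
theorem laguerreCoeff_fracHankelClifford {β : ℝ} (hβ : 0 < β)
    {S : Submodule ℂ ((Fin d → ℕ) → ℂ)} (hS : S ≤ roumieuSub d β) {z : ℂ} (hz : ‖z‖ = 1)
    (hz1 : z ≠ 1) (f : laguerreSeries d S) :
    laguerreCoeff (fracHankelClifford z f.1) = mulPow z (laguerreCoeff f.1) :=
  funext fun m => (integrable_and_laguerreCoeff_of_hasSum hβ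
    (mulPow_mem_roumieuSub hz (hS f.2.2.1)) (hasSum_fracHankelClifford hβ hS hz hz1 f) m).2

theorem fracHankelClifford_mem {β : ℝ} (hβ : 0 < β) {S : Submodule ℂ ((Fin d → ℕ) → ℂ)}
    (hS : S ≤ roumieuSub d β) {z : ℂ} (hz : ‖z‖ = 1) (hz1 : z ≠ 1)
    (hmul : ∀ a ∈ S, mulPow z a ∈ S) (f : laguerreSeries d S) :
    fracHankelClifford z f.1 ∈ laguerreSeries d S := by
  have hc := laguerreCoeff_fracHankelClifford hβ hS hz hz1 f
  refine ⟨fun m => (integrable_and_laguerreCoeff_of_hasSum hβ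
    (mulPow_mem_roumieuSub hz (hS f.2.2.1)) (hasSum_fracHankelClifford hβ hS hz hz1 f) m).1, ?_,
    fun x => ?_⟩
  · rw [hc]
    exact hmul _ f.2.2.1
  · rw [hc]
    exact hasSum_fracHankelClifford hβ hS hz hz1 f x

/-- The fractional transform as a linear endomorphism of a space of Laguerre series. -/
def fracLinearMap {β : ℝ} (hβ : 0 < β) {S : Submodule ℂ ((Fin d → ℕ) → ℂ)}
    (hS : S ≤ roumieuSub d β) {z : ℂ} (hz : ‖z‖ = 1) (hz1 : z ≠ 1)
    (hmul : ∀ a ∈ S, mulPow z a ∈ S) : laguerreSeries d S →ₗ[ℂ] laguerreSeries d S where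
  toFun f := ⟨fracHankelClifford z f.1, fracHankelClifford_mem hβ hS hz hz1 hmul f⟩
  map_add' f g := by
    apply Subtype.ext
    funext x
    change ((1 - z) ^ d)⁻¹ * ∫ y, (f.1 y + g.1 y) * fracKernel z x y ∂(lebesgue d) =
      ((1 - z) ^ d)⁻¹ * (∫ y, f.1 y * fracKernel z x y ∂(lebesgue d)) +
      ((1 - z) ^ d)⁻¹ * ∫ y, g.1 y * fracKernel z x y ∂(lebesgue d)
    simp only [add_mul]
    rw [integral_add (integrable_mul_fracKernel hβ hS hz hz1 f x)
      (integrable_mul_fracKernel hβ hS hz hz1 g x), mul_add]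
  map_smul' c f := by
    apply Subtype.ext
    funext x
    change ((1 - z) ^ d)⁻¹ * ∫ y, (c * f.1 y) * fracKernel z x y ∂(lebesgue d) =
      c * (((1 - z) ^ d)⁻¹ * ∫ y, f.1 y * fracKernel z x y ∂(lebesgue d))
    simp only [mul_assoc c]
    rw [integral_const_mul, mul_left_comm]

theorem laguerreCoeff_fracLinearMap {β : ℝ} (hβ : 0 < β) {S : Submodule ℂ ((Fin d → ℕ) → ℂ)}
    (hS : S ≤ roumieuSub d β) {z : ℂ} (hz : ‖z‖ = 1) (hz1 : z ≠ 1)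
    (hmul : ∀ a ∈ S, mulPow z a ∈ S) (f : laguerreSeries d S) :
    laguerreCoeff (fracLinearMap hβ hS hz hz1 hmul f).1 = mulPow z (laguerreCoeff f.1) :=
  laguerreCoeff_fracHankelClifford hβ hS hz hz1 f

/-- The separate `w` lets the same statement serve for both compositions, where `z = (z⁻¹)⁻¹` holds
only propositionally. -/
theorem fracLinearMap_fracLinearMap_inv {β : ℝ} (hβ : 0 < β)
    {S : Submodule ℂ ((Fin d → ℕ) → ℂ)} (hS : S ≤ roumieuSub d β) {z w : ℂ} (hz : ‖z‖ = 1)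
    (hz1 : z ≠ 1) (hw : ‖w‖ = 1) (hw1 : w ≠ 1) (hzw : w = z⁻¹)
    (hmul : ∀ a ∈ S, mulPow z a ∈ S) (hmul' : ∀ a ∈ S, mulPow w a ∈ S)
    (f : laguerreSeries d S) :
    fracLinearMap hβ hS hz hz1 hmul (fracLinearMap hβ hS hw hw1 hmul' f) = f := by
  apply laguerreSeries_ext
  rw [laguerreCoeff_fracLinearMap, laguerreCoeff_fracLinearMap, hzw, mulPow_mulPow_inv hz]

theorem norm_inv_eq_one {z : ℂ} (hz : ‖z‖ = 1) : ‖z⁻¹‖ = 1 := by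
  rw [norm_inv, hz, inv_one]

theorem inv_ne_one_of_ne_one {z : ℂ} (hz1 : z ≠ 1) : z⁻¹ ≠ 1 := by
  rwa [ne_eq, inv_eq_one]

/-- The fractional transform as a linear automorphism of a space of Laguerre series. -/
def fracLinearEquiv {β : ℝ} (hβ : 0 < β) {S : Submodule ℂ ((Fin d → ℕ) → ℂ)}
    (hS : S ≤ roumieuSub d β) (hmul : ∀ z : ℂ, ‖z‖ = 1 → ∀ a ∈ S, mulPow z a ∈ S) {z : ℂ}
    (hz : ‖z‖ = 1) (hz1 : z ≠ 1) : laguerreSeries d S ≃ₗ[ℂ] laguerreSeries d S :=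
  LinearEquiv.ofLinearMap (fracLinearMap hβ hS hz hz1 (hmul z hz))
    (fracLinearMap hβ hS (norm_inv_eq_one hz) (inv_ne_one_of_ne_one hz1)
      (hmul _ (norm_inv_eq_one hz)))
    (LinearMap.ext fun f => fracLinearMap_fracLinearMap_inv hβ hS hz hz1
      (norm_inv_eq_one hz) (inv_ne_one_of_ne_one hz1) rfl (hmul z hz)
      (hmul _ (norm_inv_eq_one hz)) f)
    (LinearMap.ext fun f => fracLinearMap_fracLinearMap_inv hβ hS (norm_inv_eq_one hz)
      (inv_ne_one_of_ne_one hz1) hz hz1 (inv_inv z).symm (hmul _ (norm_inv_eq_one hz))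
      (hmul z hz) f)

/-- The fractional transform as a topological automorphism of `𝒢_{0,α}`. -/
def fracBeurling (d : ℕ) {α : ℝ} (hα : 0 < α) {z : ℂ} (hz : ‖z‖ = 1) (hz1 : z ≠ 1) :
    BeurlingG d α ≃L[ℂ] BeurlingG d α :=
  { (fracLinearEquiv (half_pos hα) (beurlingSub_le_roumieuSub d (α / 2))
      (fun _ hz _ => mulPow_mem_beurlingSub hz) hz hz1 : BeurlingG d α ≃ₗ[ℂ] BeurlingG d α) with
    continuous_toFun := by
      -- The topology is induced by the coefficient map, so continuity reduces to that of
      -- multiplication by `z^{|n|}`.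
      refine continuous_induced_rng.mpr
        (((continuous_mulPowBeurling hz (α / 2)).comp continuous_induced_dom).congr fun f => ?_)
      exact Subtype.ext (laguerreCoeff_fracLinearMap (half_pos hα)
        (beurlingSub_le_roumieuSub d (α / 2)) hz hz1 (fun _ => mulPow_mem_beurlingSub hz) f).symm
    continuous_invFun := by
      refine continuous_induced_rng.mpr
        (((continuous_mulPowBeurling (norm_inv_eq_one hz) (α / 2)).comp
          continuous_induced_dom).congr fun f => ?_)
      exact Subtype.ext (laguerreCoeff_fracLinearMap (half_pos hα)
        (beurlingSub_le_roumieuSub d (α / 2)) (norm_inv_eq_one hz) (inv_ne_one_of_ne_one hz1)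
        (fun _ => mulPow_mem_beurlingSub (norm_inv_eq_one hz)) f).symm }

/-- The fractional transform as a topological automorphism of `𝒢_α`. -/
def fracRoumieu (d : ℕ) {α : ℝ} (hα : 0 < α) {z : ℂ} (hz : ‖z‖ = 1) (hz1 : z ≠ 1) :
    RoumieuG d α ≃L[ℂ] RoumieuG d α :=
  { (fracLinearEquiv (half_pos hα) le_rfl
      (fun _ hz _ => mulPow_mem_roumieuSub hz) hz hz1 : RoumieuG d α ≃ₗ[ℂ] RoumieuG d α) with
    continuous_toFun := by
      refine continuous_induced_rng.mpr
        (((continuous_mulPowRoumieu hz (α / 2)).comp continuous_induced_dom).congr fun f => ?_)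
      exact Subtype.ext (laguerreCoeff_fracLinearMap (half_pos hα) le_rfl hz hz1 (fun _ => mulPow_mem_roumieuSub hz) f).symm
    continuous_invFun := by
      refine continuous_induced_rng.mpr
        (((continuous_mulPowRoumieu (norm_inv_eq_one hz) (α / 2)).comp
          continuous_induced_dom).congr fun f => ?_)
      exact Subtype.ext (laguerreCoeff_fracLinearMap (half_pos hα) le_rfl
        (norm_inv_eq_one hz) (inv_ne_one_of_ne_one hz1)
        (fun _ => mulPow_mem_roumieuSub (norm_inv_eq_one hz)) f).symm }

/-! ### The Hankel–Clifford transform is the case `z = -1` -/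

/-- At `z = -1` the exponent vanishes and `|1 - z| = 2` cancels the factor in the Bessel argument.
-/
theorem fracKernel₁_neg_one {x y : ℝ} (hx : 0 ≤ x) (hy : 0 ≤ y) :
    fracKernel₁ (-1) x y = (besselJ0 (Real.sqrt (x * y)) : ℂ) := by
  rw [fracKernel₁_eq (by simp) (by norm_num) hx hy]
  norm_num

theorem fracKernel_neg_one (x y : Orthant d) : fracKernel (-1) x y = (hankelKernel x y : ℂ) := by
  rw [fracKernel_eq_prod, hankelKernel]
  push_cast
  exact Finset.prod_congr rfl fun j _ => fracKernel₁_neg_one (x j).2.le (y j).2.le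

theorem fracHankelClifford_neg_one (f : Orthant d → ℂ) (x : Orthant d) :
    fracHankelClifford (-1) f x = hankelClifford f x := by
  simp only [fracHankelClifford, hankelClifford, fracKernel_neg_one]
  norm_num

theorem fracBeurling_spec {α : ℝ} (hα : 0 < α) {z : ℂ} (hz : ‖z‖ = 1) (hz1 : z ≠ 1)
    (f : BeurlingG d α) (x : Orthant d) :
    Integrable (fun y => f y * fracKernel z x y) (lebesgue d) ∧
      (fracBeurling d hα hz hz1 f) x = fracHankelClifford z f x :=
  ⟨integrable_mul_fracKernel (half_pos hα) (beurlingSub_le_roumieuSub d (α / 2)) hz hz1 f x, rfl⟩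

theorem fracRoumieu_spec {α : ℝ} (hα : 0 < α) {z : ℂ} (hz : ‖z‖ = 1) (hz1 : z ≠ 1)
    (f : RoumieuG d α) (x : Orthant d) :
    Integrable (fun y => f y * fracKernel z x y) (lebesgue d) ∧
      (fracRoumieu d hα hz hz1 f) x = fracHankelClifford z f x :=
  ⟨integrable_mul_fracKernel (half_pos hα) le_rfl hz hz1 f x, rfl⟩

end HankelClifford

end

/-! ### The isomorphism theorem. -/

theorem corollary3p6 (d : ℕ) (hd : 0 < d) (α : ℝ) (hα : 0 < α) :
    (∀ z : ℂ, ‖z‖ = 1 → z ≠ 1 →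
      (∃ Φ : HankelClifford.BeurlingG d α ≃L[ℂ] HankelClifford.BeurlingG d α,
        ∀ (f : HankelClifford.BeurlingG d α) (x : HankelClifford.Orthant d),
          Integrable (fun y => f y * HankelClifford.fracKernel z x y)
            (HankelClifford.lebesgue d) ∧
          (Φ f) x = HankelClifford.fracHankelClifford z f x) ∧
      (∃ Φ : HankelClifford.RoumieuG d α ≃L[ℂ] HankelClifford.RoumieuG d α,
        ∀ (f : HankelClifford.RoumieuG d α) (x : HankelClifford.Orthant d),
          Integrable (fun y => f y * HankelClifford.fracKernel z x y)
            (HankelClifford.lebesgue d) ∧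
          (Φ f) x = HankelClifford.fracHankelClifford z f x)) ∧
    (∃ Φ : HankelClifford.BeurlingG d α ≃L[ℂ] HankelClifford.BeurlingG d α,
      ∀ (f : HankelClifford.BeurlingG d α) (x : HankelClifford.Orthant d),
        Integrable (fun y => f y * (HankelClifford.hankelKernel x y : ℂ))
          (HankelClifford.lebesgue d) ∧
        (Φ f) x = HankelClifford.hankelClifford f x) ∧
    (∃ Φ : HankelClifford.RoumieuG d α ≃L[ℂ] HankelClifford.RoumieuG d α,
      ∀ (f : HankelClifford.RoumieuG d α) (x : HankelClifford.Orthant d),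
        Integrable (fun y => f y * (HankelClifford.hankelKernel x y : ℂ))
          (HankelClifford.lebesgue d) ∧
        (Φ f) x = HankelClifford.hankelClifford f x) := by
  have h1 : ‖(-1 : ℂ)‖ = 1 := by simp
  have h2 : (-1 : ℂ) ≠ 1 := by norm_num
  refine ⟨fun z hz hz1 => ⟨⟨_, HankelClifford.fracBeurling_spec hα hz hz1⟩,
    ⟨_, HankelClifford.fracRoumieu_spec hα hz hz1⟩⟩,
    ⟨HankelClifford.fracBeurling d hα h1 h2, fun f x => ?_⟩,
    ⟨HankelClifford.fracRoumieu d hα h1 h2, fun f x => ?_⟩⟩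
  · simpa only [HankelClifford.fracKernel_neg_one, HankelClifford.fracHankelClifford_neg_one]
      using HankelClifford.fracBeurling_spec hα h1 h2 f x
  · simpa only [HankelClifford.fracKernel_neg_one, HankelClifford.fracHankelClifford_neg_one]
      using HankelClifford.fracRoumieu_spec hα h1 h2 f x
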